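/- Let $k\ge 2$ and let $\varphi_k:(\mathbb R^{2k-2},0)\to(\mathbb R^{2k-1},0)$ be the real minimal cross cap mapping of multiplicity $k$, \[ \varphi_k(u_1,\dots,u_{k-2},v_1,\dots,v_{k-1},y)=\Bigl(u_1,\dots,u_{k-2},v_1,\dots,v_{k-1},\;y^k+\sum_{i=1}^{k-2}u_iy^i,\;\sum_{i=1}^{k-1}v_iy^i\Bigr), \] with coordinates $U_1,\dots,U_{k-2},V_1,\dots,V_{k-1},W_1,W_2$ on the target. A vector field $\xi$ on the target is liftable over $\varphi_k$ if there is a smooth vector field $\eta$ on a neighbourhood of $0$ in $\mathbb R^{2k-2}$ with $d\varphi_k\circ\eta=\xi\circ\varphi_k$ there. Put $U_{k-1}=V_k=0$, $U_k=1$, and $U_r=V_r=0$ for $r\le 0$ and for $r>k$. Write a vector field on the target as a tuple $(A_1,\dots,A_{k-2},B_1,\dots,B_{k-1},C_1,C_2)$. Let \[ \xi_e:\quad A_i=(k-i)U_i,\qquad B_i=(k-i)V_i,\qquad C_1=kW_1,\qquad C_2=kW_2 , \] and for $1\le j\le k-1$ let $\xi^1_j,\xi^2_j,\xi^3_j$ be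 the polynomial vector fields with the following components. $\xi^1_j$: \begin{align*} A_i&=(k-i)(k-j)U_iU_j,\\ B_i&=k\sum_{r=1}^{i-1}U_{i+j-r}V_r-k\sum_{r=1}^{i}U_rV_{i+j-r}-(i-1)(k-j)U_jV_i+kV_{i+j}W_1-kU_{i+j}W_2,\\ C_1&=k(k-j)U_jW_1,\qquad C_2=-kV_jW_1+(k-j)U_jW_2. \end{align*} $\xi^2_j$: \begin{align*} A_i&=-k(k+i-j+1)U_{k+i-j+1}W_1+k\sum_{r=1}^{i}(k+i-j-2r+1)U_rU_{k+i-j-r+1}-j(i+1)U_{i+1}U_{k-j},\\ B_i&=-k(k+i-j+1)V_{k+i-j+1}W_1+k\sum_{r=1}^{i}(k+i-j-r+1)U_rV_{k+i-j-r+1}\\ &\qquad-k\sum_{r=1}^{i}rU_{k+i-j-r+1}V_r-j(i+1)U_{k-j}V_{i+1},\\ C_1&=k(k-j+1)U_{k-j+1}W_1+jU_1U_{k-j},\qquad C_2=k(k-j+1)V_{k-j+1}W_1+jV_1U_{k-j}. \end{align*} $\xi^3_j$: \begin{align*} A_i&=-k(k+i-j+1)U_{k+i-j+1}W_2+k\sum_{r=1}^{i}(k+i-j-r+1)U_{k+i-j-r+1}V_r\\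 &\qquad-k\sum_{r=1}^{i}rU_rV_{k+i-j-r+1}-k(i+1)U_{i+1}V_{k-j},\\ B_i&=-k(k+i-j+1)V_{k+i-j+1}W_2+k\sum_{r=1}^{i}(k+i-j-2r+1)V_rV_{k+i-j-r+1}-k(i+1)V_{i+1}V_{k-j},\\ C_1&=k(k-j+1)U_{k-j+1}W_2+kU_1V_{k-j},\qquad C_2=k(k-j+1)V_{k-j+1}W_2+kV_1V_{k-j}. \end{align*} Then the module, over the polynomial ring $\mathbb R[U_1,\dots,U_{k-2},V_1,\dots,V_{k-1},W_1,W_2]$, of the polynomial vector fields liftable over $\varphi_k$ is generated by $\xi_e$ and the vector fields $\xi^1_j,\xi^2_j,\xi^3_j$ for $1\le j\le k-1$. -/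

import Mathlib

open scoped ContDiff

noncomputable section

namespace CrossCap

/-- A vector field `ξ` on the target is liftable over the map germ `f` at the origin: there is a
smooth vector field `η` near the origin of the source with `df ∘ η = ξ ∘ f` there. -/
def LiftableOver {σ τ : Type*} [Fintype σ] [Fintype τ]
    (f : (σ → ℝ) → (τ → ℝ)) (ξ : (τ → ℝ) → (τ → ℝ)) : Prop :=
  ∃ s : Set (σ → ℝ), IsOpen s ∧ (0 : σ → ℝ) ∈ s ∧
    ∃ η : (σ → ℝ) → (σ → ℝ), ContDiffOn ℝ ∞ η s ∧
      ∀ x ∈ s, fderiv ℝ f x (η x) = ξ (f x)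

/-- Polynomial vector fields on `ℝ^τ`, written as tuples of components. -/
abbrev PolyField (τ : Type*) := τ → MvPolynomial τ ℝ

/-- The vector field (as a function) defined by a polynomial vector field. -/
def PolyField.toFun {τ : Type*} (ξ : PolyField τ) (X : τ → ℝ) : τ → ℝ :=
  fun t => MvPolynomial.eval X (ξ t)

theorem contDiff_eval {τ : Type*} [Fintype τ] (p : MvPolynomial τ ℝ) :
    ContDiff ℝ ∞ (fun X : τ → ℝ => MvPolynomial.eval X p) := by
  induction p using MvPolynomial.induction_on with
  | C a => simpa using contDiff_const
  | add p q hp hq => simpa using hp.add hq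
  | mul_X p i hp => simpa using hp.mul (contDiff_apply ℝ ℝ i)

/-- The module, over the polynomial ring of the target, of the polynomial vector fields that are
liftable over the smooth map `f`. -/
def liftablePolyFields {σ τ : Type*} [Fintype σ] [Fintype τ]
    (f : (σ → ℝ) → (τ → ℝ)) (hf : ContDiff ℝ ∞ f) :
    Submodule (MvPolynomial τ ℝ) (PolyField τ) where
  carrier := {ξ | LiftableOver f ξ.toFun}
  zero_mem' := ⟨Set.univ, isOpen_univ, Set.mem_univ _, 0, contDiffOn_const,
    fun x _ => by ext t; simp [PolyField.toFun]⟩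
  add_mem' := by
    rintro ξ ζ ⟨s, hs, h0s, η, hη, h⟩ ⟨s', hs', h0s', η', hη', h'⟩
    refine ⟨s ∩ s', hs.inter hs', ⟨h0s, h0s'⟩, η + η',
      (hη.mono Set.inter_subset_left).add (hη'.mono Set.inter_subset_right), ?_⟩
    intro x hx
    ext t
    simp [h x hx.1, h' x hx.2, PolyField.toFun]
  smul_mem' := by
    rintro p ξ ⟨s, hs, h0s, η, hη, h⟩
    refine ⟨s, hs, h0s, fun x => MvPolynomial.eval (f x) p • η x,
      (((contDiff_eval p).comp hf).contDiffOn).smul hη, ?_⟩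
    intro x hx
    ext t
    simp [h x hx, PolyField.toFun]

/-- Source coordinates `u_1, …, u_{k-2}`, `v_1, …, v_{k-1}`, `y`; the index `i` of `Fin` stands for
the subscript `i + 1`. -/
abbrev Src (k : ℕ) := Fin (k - 2) ⊕ Fin (k - 1) ⊕ Unit

/-- Target coordinates `U_1, …, U_{k-2}`, `V_1, …, V_{k-1}`, `W_1, W_2`; the index `i` of `Fin`
stands for the subscript `i + 1`. -/
abbrev Tgt (k : ℕ) := Fin (k - 2) ⊕ Fin (k - 1) ⊕ Fin 2

/-- The tuple with entries `A_1, …, A_{k-2}, B_1, …, B_{k-1}, C_1, C_2`. -/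
def tuple {α : Type*} (k : ℕ) (A B : ℤ → α) (C₁ C₂ : α) : Tgt k → α :=
  Sum.elim (fun i => A ((i : ℤ) + 1)) (Sum.elim (fun i => B ((i : ℤ) + 1)) ![C₁, C₂])

/-- The minimal cross cap mapping of multiplicity `k`,
`(u, v, y) ↦ (u, v, y^k + ∑ u_i y^i, ∑ v_i y^i)`. -/
def crossCap (k : ℕ) (x : Src k → ℝ) : Tgt k → ℝ :=
  let u : Fin (k - 2) → ℝ := fun i => x (Sum.inl i)
  let v : Fin (k - 1) → ℝ := fun i => x (Sum.inr (Sum.inl i))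
  let y : ℝ := x (Sum.inr (Sum.inr ()))
  Sum.elim u (Sum.elim v
    ![y ^ k + ∑ i, u i * y ^ ((i : ℕ) + 1), ∑ i, v i * y ^ ((i : ℕ) + 1)])

theorem contDiff_crossCap (k : ℕ) : ContDiff ℝ ∞ (crossCap k) := by
  refine contDiff_pi.2 ?_
  rintro (i | i | i)
  · exact contDiff_apply ℝ ℝ _
  · exact contDiff_apply ℝ ℝ _
  · fin_cases i <;> simp only [crossCap, Sum.elim_inr] <;> simp <;> fun_prop

/-- `U_r` for every integer `r`: the coordinate for `1 ≤ r ≤ k - 2`, with `U_k = 1` and `U_r = 0`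
for all other `r`. -/
def U (k : ℕ) (r : ℤ) : MvPolynomial (Tgt k) ℝ :=
  if h : 1 ≤ r ∧ r ≤ (k : ℤ) - 2 then
    MvPolynomial.X (Sum.inl ⟨(r - 1).toNat, by omega⟩)
  else if r = k then 1 else 0

/-- `V_r` for every integer `r`: the coordinate for `1 ≤ r ≤ k - 1`, and `V_r = 0` for all other
`r`. -/
def V (k : ℕ) (r : ℤ) : MvPolynomial (Tgt k) ℝ :=
  if h : 1 ≤ r ∧ r ≤ (k : ℤ) - 1 then
    MvPolynomial.X (Sum.inr (Sum.inl ⟨(r - 1).toNat, by omega⟩))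
  else 0

def W₁ (k : ℕ) : MvPolynomial (Tgt k) ℝ := MvPolynomial.X (Sum.inr (Sum.inr 0))

def W₂ (k : ℕ) : MvPolynomial (Tgt k) ℝ := MvPolynomial.X (Sum.inr (Sum.inr 1))

/-- The Euler vector field of `crossCap k`. -/
def eulerField (k : ℕ) : PolyField (Tgt k) :=
  tuple k
    (fun i => ((k - i : ℤ) : MvPolynomial (Tgt k) ℝ) * U k i)
    (fun i => ((k - i : ℤ) : MvPolynomial (Tgt k) ℝ) * V k i)
    ((k : MvPolynomial (Tgt k) ℝ) * W₁ k)
    ((k : MvPolynomial (Tgt k) ℝ) * W₂ k)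

/-- The first family `ξ^1_j`. -/
def xi₁ (k : ℕ) (j : ℤ) : PolyField (Tgt k) :=
  tuple k
    (fun i => (((k - i) * (k - j) : ℤ) : MvPolynomial (Tgt k) ℝ) * U k i * U k j)
    (fun i =>
      (k : MvPolynomial (Tgt k) ℝ) * (∑ r ∈ Finset.Icc 1 (i - 1), U k (i + j - r) * V k r)
        - (k : MvPolynomial (Tgt k) ℝ) * (∑ r ∈ Finset.Icc 1 i, U k r * V k (i + j - r))
        - (((i - 1) * (k - j) : ℤ) : MvPolynomial (Tgt k) ℝ) * U k j * V k i
        + (k : MvPolynomial (Tgt k) ℝ) * V k (i + j) * W₁ k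
        - (k : MvPolynomial (Tgt k) ℝ) * U k (i + j) * W₂ k)
    (((k * (k - j) : ℤ) : MvPolynomial (Tgt k) ℝ) * U k j * W₁ k)
    (-((k : MvPolynomial (Tgt k) ℝ) * V k j * W₁ k)
      + ((k - j : ℤ) : MvPolynomial (Tgt k) ℝ) * U k j * W₂ k)

/-- The second family `ξ^2_j`. -/
def xi₂ (k : ℕ) (j : ℤ) : PolyField (Tgt k) :=
  tuple k
    (fun i =>
      -(((k * (k + i - j + 1) : ℤ) : MvPolynomial (Tgt k) ℝ) * U k (k + i - j + 1) * W₁ k)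
        + (k : MvPolynomial (Tgt k) ℝ) * (∑ r ∈ Finset.Icc 1 i,
            ((k + i - j - 2 * r + 1 : ℤ) : MvPolynomial (Tgt k) ℝ)
              * U k r * U k (k + i - j - r + 1))
        - ((j * (i + 1) : ℤ) : MvPolynomial (Tgt k) ℝ) * U k (i + 1) * U k (k - j))
    (fun i =>
      -(((k * (k + i - j + 1) : ℤ) : MvPolynomial (Tgt k) ℝ) * V k (k + i - j + 1) * W₁ k)
        + (k : MvPolynomial (Tgt k) ℝ) * (∑ r ∈ Finset.Icc 1 i,
            ((k + i - j - r + 1 : ℤ) : MvPolynomial (Tgt k) ℝ)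
              * U k r * V k (k + i - j - r + 1))
        - (k : MvPolynomial (Tgt k) ℝ) * (∑ r ∈ Finset.Icc 1 i,
            (r : MvPolynomial (Tgt k) ℝ) * U k (k + i - j - r + 1) * V k r)
        - ((j * (i + 1) : ℤ) : MvPolynomial (Tgt k) ℝ) * U k (k - j) * V k (i + 1))
    (((k * (k - j + 1) : ℤ) : MvPolynomial (Tgt k) ℝ) * U k (k - j + 1) * W₁ k
      + (j : MvPolynomial (Tgt k) ℝ) * U k 1 * U k (k - j))
    (((k * (k - j + 1) : ℤ) : MvPolynomial (Tgt k) ℝ) * V k (k - j + 1) * W₁ k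
      + (j : MvPolynomial (Tgt k) ℝ) * V k 1 * U k (k - j))

/-- The third family `ξ^3_j`. -/
def xi₃ (k : ℕ) (j : ℤ) : PolyField (Tgt k) :=
  tuple k
    (fun i =>
      -(((k * (k + i - j + 1) : ℤ) : MvPolynomial (Tgt k) ℝ) * U k (k + i - j + 1) * W₂ k)
        + (k : MvPolynomial (Tgt k) ℝ) * (∑ r ∈ Finset.Icc 1 i,
            ((k + i - j - r + 1 : ℤ) : MvPolynomial (Tgt k) ℝ)
              * U k (k + i - j - r + 1) * V k r)
        - (k : MvPolynomial (Tgt k) ℝ) * (∑ r ∈ Finset.Icc 1 i,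
            (r : MvPolynomial (Tgt k) ℝ) * U k r * V k (k + i - j - r + 1))
        - ((k * (i + 1) : ℤ) : MvPolynomial (Tgt k) ℝ) * U k (i + 1) * V k (k - j))
    (fun i =>
      -(((k * (k + i - j + 1) : ℤ) : MvPolynomial (Tgt k) ℝ) * V k (k + i - j + 1) * W₂ k)
        + (k : MvPolynomial (Tgt k) ℝ) * (∑ r ∈ Finset.Icc 1 i,
            ((k + i - j - 2 * r + 1 : ℤ) : MvPolynomial (Tgt k) ℝ)
              * V k r * V k (k + i - j - r + 1))
        - ((k * (i + 1) : ℤ) : MvPolynomial (Tgt k) ℝ) * V k (i + 1) * V k (k - j))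
    (((k * (k - j + 1) : ℤ) : MvPolynomial (Tgt k) ℝ) * U k (k - j + 1) * W₂ k
      + (k : MvPolynomial (Tgt k) ℝ) * U k 1 * V k (k - j))
    (((k * (k - j + 1) : ℤ) : MvPolynomial (Tgt k) ℝ) * V k (k - j + 1) * W₂ k
      + (k : MvPolynomial (Tgt k) ℝ) * V k 1 * V k (k - j))

/-- The fields `ξ_e` and `ξ^1_j, ξ^2_j, ξ^3_j` for `1 ≤ j ≤ k - 1`. -/
def generators (k : ℕ) : Set (PolyField (Tgt k)) :=
  {eulerField k} ∪
    ⋃ j ∈ Set.Icc (1 : ℤ) ((k : ℤ) - 1), {xi₁ k j, xi₂ k j, xi₃ k j}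

end CrossCap

end

noncomputable section

namespace CrossCap

open Finset

/-! Write `P = y^k + ∑ u_i y^i`, `Q = ∑ v_i y^i`, with primes for `∂/∂y`. The `u`- and
`v`-components of a lift are forced, so a field lifts iff its two symbols `C_1 - ∑ A_i y^i` and `C_2
- ∑ B_i y^i`, pulled back to the source, equal `h P'` and `h Q'` for one multiplier `h`, the
`y`-component of the lift. Since `P'` and `Q'` are coprime, `h` can be taken polynomial
(`mem_liftable_iff`).

Each generator has an explicit multiplier. The verification rests on antisymmetric convolutions in
which all powers `y^i` with `i ≥ k` cancel (`family_identity`, `first_family_identity`).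

Conversely, the generators serve as rewriting rules that eliminate `W_1` and `W_2`, in two stages.
Modulo vertical fields (`A = 0`, `C_1 = 0`), `ξ^2_j` and `ξ^3_j` express `W_1` and `W_2` times the
fields with first symbol `y^a`, `a ≤ k - 2`, through coefficients in `ℝ[U, V]`. What is left of a
liftable field has first symbol of `y`-degree below `k - 1` and divisible by `P'`, hence zero
(`eq_zero_of_liftable₁`). For vertical fields, `ξ^1_j - (k - j) U_j ξ_e` and `k ξ_e - ξ^2_1`
eliminate `W_2`, leaving second symbol `∑_{a<k} c_a(u, v, P) y^a`. A vertical liftable field has `h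
= 0`, and `1, y, …, y^{k-1}` are independent over `ℝ[u, v][P]`, so all `c_a` vanish
(`eq_zero_of_liftable₂`). -/

theorem sum_fin_eq_sum_Icc {M : Type*} [AddCommMonoid M] (n : ℕ) (m : ℤ) (hm : m = n)
    (F : ℤ → M) : ∑ i : Fin n, F ((i : ℤ) + 1) = ∑ r ∈ Icc 1 m, F r := by
  subst hm
  refine Finset.sum_bij (fun i _ => (i : ℤ) + 1) ?_ ?_ ?_ ?_
  · intro i _
    have := i.2
    simp only [mem_Icc]
    omega
  · intro i _ j _ h
    ext
    simp only [add_left_inj, Nat.cast_inj] at h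
    exact h
  · intro r hr
    simp only [mem_Icc] at hr
    exact ⟨⟨(r - 1).toNat, by omega⟩, mem_univ _, by simp only; omega⟩
  · intros; rfl

/-! ### Pull-back to the source and the coefficient sequences. -/

/-- The ring of polynomial functions on the source. -/
abbrev SrcRing (k : ℕ) := MvPolynomial (Src k) ℝ

/-- The ring of polynomial functions on the target. -/
abbrev TgtRing (k : ℕ) := MvPolynomial (Tgt k) ℝ

/-- The coordinate `y` on the source. -/
def Y (k : ℕ) : SrcRing k := MvPolynomial.X (Sum.inr (Sum.inr ()))

/-- Pull-back of polynomial functions along `crossCap k`. -/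
def pullback (k : ℕ) : TgtRing k →ₐ[ℝ] SrcRing k :=
  MvPolynomial.aeval (Sum.elim (fun i => MvPolynomial.X (Sum.inl i))
    (Sum.elim (fun i => MvPolynomial.X (Sum.inr (Sum.inl i)))
      ![Y k ^ k + ∑ i : Fin (k - 2), MvPolynomial.X (Sum.inl i) * Y k ^ ((i : ℕ) + 1),
        ∑ i : Fin (k - 1), MvPolynomial.X (Sum.inr (Sum.inl i)) * Y k ^ ((i : ℕ) + 1)]))

theorem eval_pullback (k : ℕ) (x : Src k → ℝ) (p : TgtRing k) :
    MvPolynomial.eval x (pullback k p) = MvPolynomial.eval (crossCap k x) p := by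
  have : (MvPolynomial.aeval x).comp (pullback k) = MvPolynomial.aeval (crossCap k x) := by
    ext t
    rcases t with i | i | i
    · simp [pullback, crossCap]
    · simp [pullback, crossCap]
    · fin_cases i <;> simp [pullback, crossCap, Y]
  have h := DFunLike.congr_fun this p
  simpa [MvPolynomial.aeval_eq_eval] using h

/-- The coefficient functions `U_r` on the source. -/
def uSeq (k : ℕ) (r : ℤ) : SrcRing k := pullback k (U k r)

/-- The coefficient functions `V_r` on the source. -/
def vSeq (k : ℕ) (r : ℤ) : SrcRing k := pullback k (V k r)

theorem U_top (k : ℕ) : U k k = 1 := by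
  rw [U, dif_neg (by omega), if_pos rfl]

theorem U_pred (k : ℕ) : U k ((k : ℤ) - 1) = 0 := by
  rw [U, dif_neg (by omega), if_neg (by omega)]

theorem U_of_gt {k : ℕ} {r : ℤ} (h : (k : ℤ) < r) : U k r = 0 := by
  rw [U, dif_neg (by omega), if_neg (by omega)]

theorem V_of_ge {k : ℕ} {r : ℤ} (h : (k : ℤ) ≤ r) : V k r = 0 := by
  rw [V, dif_neg (by omega)]

theorem U_coord (k : ℕ) (i : Fin (k - 2)) : U k ((i : ℤ) + 1) = MvPolynomial.X (Sum.inl i) := by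
  have := i.2
  rw [U, dif_pos (by omega)]
  congr 2
  ext
  simp

theorem V_coord (k : ℕ) (i : Fin (k - 1)) :
    V k ((i : ℤ) + 1) = MvPolynomial.X (Sum.inr (Sum.inl i)) := by
  have := i.2
  rw [V, dif_pos (by omega)]
  congr 3
  ext
  simp

theorem uSeq_top (k : ℕ) : uSeq k k = 1 := by simp [uSeq, U_top]

theorem uSeq_pred (k : ℕ) : uSeq k ((k : ℤ) - 1) = 0 := by simp [uSeq, U_pred]

theorem uSeq_of_gt {k : ℕ} {r : ℤ} (h : (k : ℤ) < r) : uSeq k r = 0 := by simp [uSeq, U_of_gt h]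

theorem vSeq_of_ge {k : ℕ} {r : ℤ} (h : (k : ℤ) ≤ r) : vSeq k r = 0 := by simp [vSeq, V_of_ge h]

theorem uSeq_coord (k : ℕ) (i : Fin (k - 2)) :
    uSeq k ((i : ℤ) + 1) = MvPolynomial.X (Sum.inl i) := by
  simp [uSeq, U_coord, pullback]

theorem vSeq_coord (k : ℕ) (i : Fin (k - 1)) :
    vSeq k ((i : ℤ) + 1) = MvPolynomial.X (Sum.inr (Sum.inl i)) := by
  simp [vSeq, V_coord, pullback]

theorem sum_Icc_split {M : Type*} [AddCommMonoid M] {a b : ℤ} (h : a ≤ b) (F : ℤ → M) :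
    ∑ r ∈ Icc a b, F r = (∑ r ∈ Icc a (b - 1), F r) + F b := by
  have : Icc a b = insert b (Icc a (b - 1)) := by
    ext r
    simp only [mem_Icc, mem_insert]
    omega
  rw [this, sum_insert (by simp), add_comm]

/-- A sum against `u_1, …, u_{k-2}, u_{k-1} = 0, u_k = 1`. -/
theorem sum_uSeq_mul {k : ℕ} (hk : 2 ≤ k) (F : ℤ → SrcRing k) :
    ∑ r ∈ Icc 1 (k : ℤ), uSeq k r * F r =
      F k + ∑ i : Fin (k - 2), MvPolynomial.X (Sum.inl i) * F ((i : ℤ) + 1) := by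
  rw [sum_Icc_split (by omega), sum_Icc_split (by omega), uSeq_top, uSeq_pred]
  simp only [← uSeq_coord]
  rw [sum_fin_eq_sum_Icc (k - 2) ((k : ℤ) - 1 - 1) (by omega) (fun r => uSeq k r * F r)]
  ring

/-- A sum against `v_1, …, v_{k-1}, v_k = 0`. -/
theorem sum_vSeq_mul {k : ℕ} (hk : 2 ≤ k) (F : ℤ → SrcRing k) :
    ∑ r ∈ Icc 1 (k : ℤ), vSeq k r * F r =
      ∑ i : Fin (k - 1), MvPolynomial.X (Sum.inr (Sum.inl i)) * F ((i : ℤ) + 1) := by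
  rw [sum_Icc_split (by omega), vSeq_of_ge le_rfl]
  simp only [← vSeq_coord]
  rw [sum_fin_eq_sum_Icc (k - 1) ((k : ℤ) - 1) (by omega) (fun r => vSeq k r * F r)]
  ring

theorem pullback_W₁ {k : ℕ} (hk : 2 ≤ k) :
    pullback k (W₁ k) = ∑ r ∈ Icc 1 (k : ℤ), uSeq k r * Y k ^ r.toNat := by
  rw [sum_uSeq_mul hk]
  simp [W₁, pullback]

theorem pullback_W₂ {k : ℕ} (hk : 2 ≤ k) :
    pullback k (W₂ k) = ∑ r ∈ Icc 1 (k : ℤ), vSeq k r * Y k ^ r.toNat := by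
  rw [sum_vSeq_mul hk]
  simp [W₂, pullback]

/-- The derivative `k y^{k-1} + ∑ i u_i y^{i-1}`. -/
def dP (k : ℕ) : SrcRing k := ∑ r ∈ Icc 1 (k : ℤ), uSeq k r * ((r : SrcRing k) * Y k ^ (r - 1).toNat)

/-- The derivative `∑ i v_i y^{i-1}`. -/
def dQ (k : ℕ) : SrcRing k := ∑ r ∈ Icc 1 (k : ℤ), vSeq k r * ((r : SrcRing k) * Y k ^ (r - 1).toNat)

theorem dP_eq {k : ℕ} (hk : 2 ≤ k) : dP k = (k : SrcRing k) * Y k ^ (k - 1) +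
    ∑ i : Fin (k - 2), MvPolynomial.X (Sum.inl i) * (((i : ℕ) + 1 : SrcRing k) * Y k ^ (i : ℕ)) := by
  rw [dP, sum_uSeq_mul hk]
  have : ((k : ℤ) - 1).toNat = k - 1 := by omega
  simp [this]

theorem dQ_eq {k : ℕ} (hk : 2 ≤ k) : dQ k =
    ∑ i : Fin (k - 1), MvPolynomial.X (Sum.inr (Sum.inl i)) *
      (((i : ℕ) + 1 : SrcRing k) * Y k ^ (i : ℕ)) := by
  rw [dQ, sum_vSeq_mul hk]
  simp

/-! ### Liftability as a divisibility condition on symbols. -/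

/-- `C_1 - ∑ A_i y^i` on the source. -/
def symb₁ {k : ℕ} (ξ : PolyField (Tgt k)) : SrcRing k :=
  pullback k (ξ (Sum.inr (Sum.inr 0))) -
    ∑ i : Fin (k - 2), pullback k (ξ (Sum.inl i)) * Y k ^ ((i : ℕ) + 1)

/-- `C_2 - ∑ B_i y^i` on the source. -/
def symb₂ {k : ℕ} (ξ : PolyField (Tgt k)) : SrcRing k :=
  pullback k (ξ (Sum.inr (Sum.inr 1))) -
    ∑ i : Fin (k - 1), pullback k (ξ (Sum.inr (Sum.inl i))) * Y k ^ ((i : ℕ) + 1)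

theorem fderiv_crossCap {k : ℕ} (hk : 2 ≤ k) (x η : Src k → ℝ) :
    fderiv ℝ (crossCap k) x η =
      Sum.elim (fun i => η (Sum.inl i)) (Sum.elim (fun i => η (Sum.inr (Sum.inl i)))
        ![η (Sum.inr (Sum.inr ())) * MvPolynomial.eval x (dP k) +
            ∑ i : Fin (k - 2), η (Sum.inl i) * x (Sum.inr (Sum.inr ())) ^ ((i : ℕ) + 1),
          η (Sum.inr (Sum.inr ())) * MvPolynomial.eval x (dQ k) +
            ∑ i : Fin (k - 1), η (Sum.inr (Sum.inl i)) *
              x (Sum.inr (Sum.inr ())) ^ ((i : ℕ) + 1)]) := by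
  have hd : DifferentiableAt ℝ (crossCap k) x :=
    ((contDiff_crossCap k).differentiable (by simp)).differentiableAt
  have hc (t : Src k) : HasFDerivAt (fun z : Src k → ℝ => z t)
      (ContinuousLinearMap.proj (R := ℝ) (φ := fun _ : Src k => ℝ) t) x :=
    hasFDerivAt_apply t x
  have hf := hasFDerivAt_pi'.1 hd.hasFDerivAt
  funext t
  have key : ∀ L : (Src k → ℝ) →L[ℝ] ℝ, HasFDerivAt (fun z => crossCap k z t) L x →
      fderiv ℝ (crossCap k) x η t = L η := fun L hL => by
    rw [← (hf t).unique hL]; rfl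
  rcases t with i | i | i
  · exact key _ (hc _)
  · exact key _ (hc _)
  · fin_cases i
    · refine (key _ (((hc (Sum.inr (Sum.inr ()))).pow k).add (HasFDerivAt.fun_sum (u := univ)
        fun i _ => (hc (Sum.inl i)).mul ((hc (Sum.inr (Sum.inr ()))).pow ((i : ℕ) + 1))))).trans ?_
      simp only [Fin.zero_eta, Sum.elim_inr, Matrix.cons_val_zero, dP_eq hk, Y]
      simp [sum_add_distrib, mul_add, mul_sum]
      simp only [mul_comm, mul_left_comm, add_assoc]
    · refine (key _ (HasFDerivAt.fun_sum (u := univ)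
        fun i _ => (hc (Sum.inr (Sum.inl i))).mul
          ((hc (Sum.inr (Sum.inr ()))).pow ((i : ℕ) + 1)))).trans ?_
      simp only [Fin.mk_one, Sum.elim_inr, Matrix.cons_val_one, Matrix.cons_val_zero, dQ_eq hk, Y]
      simp [sum_add_distrib, mul_sum]
      simp only [mul_comm, mul_left_comm]

theorem eq_of_eval_eq_on_open {σ : Type*} [Fintype σ] {s : Set (σ → ℝ)} (hs : IsOpen s)
    {x₀ : σ → ℝ} (hx₀ : x₀ ∈ s) {p q : MvPolynomial σ ℝ}
    (h : ∀ x ∈ s, MvPolynomial.eval x p = MvPolynomial.eval x q) : p = q := by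
  obtain ⟨ε, hε, hb⟩ := Metric.isOpen_iff.1 hs x₀ hx₀
  refine MvPolynomial.funext_set (fun i => Metric.ball (x₀ i) ε) (fun i => ?_) fun x hx => ?_
  · rw [Real.ball_eq_Ioo]
    exact Set.Ioo_infinite (by linarith)
  · refine h x (hb ?_)
    rw [Metric.mem_ball, dist_pi_lt_iff hε]
    exact fun i => hx i (Set.mem_univ i)

/-- If `p Q' = q P'` then `(p, q)` is a multiple of `(P', Q')`. -/
theorem exists_of_mul_dQ_eq_mul_dP {k : ℕ} (hk : 2 ≤ k) {p q : SrcRing k}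
    (h : p * dQ k = q * dP k) : ∃ g, p = g * dP k ∧ q = g * dQ k := by
  classical
  set t : Src k := Sum.inr (Sum.inl ⟨0, by omega⟩) with ht
  -- `Q'` is `v_1` plus terms free of `v_1`, so the substitution `v_1 ↦ v_1 - Q'` is reduction
  -- modulo `Q'`: it kills `Q'`, fixes `P'`, and moves every `f` by a multiple of `Q'`. Applied to
  -- `p Q' = q P'` it gives `S q = 0`, that is `Q' ∣ q`.
  let S : SrcRing k →ₐ[ℝ] SrcRing k :=
    MvPolynomial.aeval (fun s => if s = t then MvPolynomial.X t - dQ k else MvPolynomial.X s)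
  have hdvd : ∀ f, dQ k ∣ f - S f := by
    intro f
    induction f using MvPolynomial.induction_on with
    | C a => simp [S, MvPolynomial.algebraMap_eq]
    | add f g hf hg => rw [map_add, add_sub_add_comm]; exact dvd_add hf hg
    | mul_X f i hf =>
      have hX : dQ k ∣ MvPolynomial.X i - S (MvPolynomial.X i) := by
        by_cases hi : i = t <;> simp [S, hi]
      have : f * MvPolynomial.X i - S (f * MvPolynomial.X i) =
          (f - S f) * MvPolynomial.X i + S f * (MvPolynomial.X i - S (MvPolynomial.X i)) := by
        rw [map_mul]; ring
      rw [this]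
      exact dvd_add (hf.mul_right _) (hX.mul_left _)
  have hY : S (Y k) = Y k := by simp [S, Y, ht]
  have hSP : S (dP k) = dP k := by
    simp [dP_eq hk, hY]
    simp [S, ht]
  have hSQ : S (dQ k) = 0 := by
    have h1 : dQ k - S (dQ k) = dQ k := by
      rw [dQ_eq hk, map_sum, ← sum_sub_distrib]
      rw [sum_eq_single (⟨0, by omega⟩ : Fin (k - 1))]
      · simp [S, ht, dQ_eq hk]
      · intro i _ hi
        have hX : S (MvPolynomial.X (Sum.inr (Sum.inl i))) =
            MvPolynomial.X (Sum.inr (Sum.inl i)) := by simp [S, ht, hi]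
        simp only [map_mul, map_add, map_natCast, map_one, map_pow, hY, hX, sub_self]
      · simp
    exact sub_eq_self.1 h1
  have hP0 : dP k ≠ 0 := by
    intro h0
    have := congrArg (MvPolynomial.eval (fun s : Src k => if s = Sum.inr (Sum.inr ()) then 1 else 0))
      h0
    simp [dP_eq hk, Y] at this
    omega
  have hSq : S q = 0 := by
    have := congrArg S h
    rw [map_mul, map_mul, hSQ, hSP, mul_zero] at this
    exact (mul_eq_zero.1 this.symm).resolve_right hP0
  have hQ0 : dQ k ≠ 0 := by
    intro h0
    have := congrArg (MvPolynomial.eval (fun s : Src k => if s = t then 1 else 0)) h0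
    rw [dQ_eq hk, map_sum, sum_eq_single (⟨0, by omega⟩ : Fin (k - 1))] at this
    · simp [ht] at this
    · intro i _ hi
      simp [ht, hi]
    · simp
  obtain ⟨g, hg⟩ := hdvd q
  rw [hSq, sub_zero] at hg
  refine ⟨g, mul_right_cancel₀ hQ0 ?_, by rw [hg, mul_comm]⟩
  rw [h, hg]
  ring

/-- The lift must have `u`- and `v`-components `A_i`, `B_i` composed with the map, so only its
`y`-component is free. Eliminating that component gives a polynomial identity on an open set, hence
everywhere, and coprimality of `P'` and `Q'` returns a polynomial multiplier. Smooth local lifts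
therefore give nothing beyond polynomial global ones. -/
theorem mem_liftable_iff {k : ℕ} (hk : 2 ≤ k) (ξ : PolyField (Tgt k)) :
    ξ ∈ liftablePolyFields (crossCap k) (contDiff_crossCap k) ↔
      ∃ h : SrcRing k, symb₁ ξ = h * dP k ∧ symb₂ ξ = h * dQ k := by
  have e₁ (x : Src k → ℝ) : MvPolynomial.eval x (symb₁ ξ) = ξ.toFun (crossCap k x)
      (Sum.inr (Sum.inr 0)) - ∑ i : Fin (k - 2), ξ.toFun (crossCap k x) (Sum.inl i) *
        x (Sum.inr (Sum.inr ())) ^ ((i : ℕ) + 1) := by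
    simp [symb₁, eval_pullback, PolyField.toFun, Y]
  have e₂ (x : Src k → ℝ) : MvPolynomial.eval x (symb₂ ξ) = ξ.toFun (crossCap k x)
      (Sum.inr (Sum.inr 1)) - ∑ i : Fin (k - 1), ξ.toFun (crossCap k x) (Sum.inr (Sum.inl i)) *
        x (Sum.inr (Sum.inr ())) ^ ((i : ℕ) + 1) := by
    simp [symb₂, eval_pullback, PolyField.toFun, Y]
  constructor
  · rintro ⟨s, hs, h0, η, -, h⟩
    apply exists_of_mul_dQ_eq_mul_dP hk
    refine eq_of_eval_eq_on_open hs h0 fun x hx => ?_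
    have hx' := h x hx
    rw [fderiv_crossCap hk] at hx'
    have hA (i) : η x (Sum.inl i) = ξ.toFun (crossCap k x) (Sum.inl i) :=
      congrFun hx' (Sum.inl i)
    have hB (i) : η x (Sum.inr (Sum.inl i)) = ξ.toFun (crossCap k x) (Sum.inr (Sum.inl i)) :=
      congrFun hx' (Sum.inr (Sum.inl i))
    have h₁ := congrFun hx' (Sum.inr (Sum.inr 0))
    have h₂ := congrFun hx' (Sum.inr (Sum.inr 1))
    simp only [Sum.elim_inr, Matrix.cons_val_zero, Matrix.cons_val_one, hA, hB] at h₁ h₂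
    rw [map_mul, map_mul, e₁, e₂, ← h₁, ← h₂]
    ring
  · rintro ⟨h, h₁, h₂⟩
    refine ⟨Set.univ, isOpen_univ, Set.mem_univ _, fun x => Sum.elim
      (fun i => ξ.toFun (crossCap k x) (Sum.inl i)) (Sum.elim
      (fun i => ξ.toFun (crossCap k x) (Sum.inr (Sum.inl i))) fun _ => MvPolynomial.eval x h),
      ContDiff.contDiffOn (contDiff_pi.2 ?_), fun x _ => ?_⟩
    · rintro (i | i | i)
      · exact (contDiff_eval _).comp (contDiff_crossCap k)
      · exact (contDiff_eval _).comp (contDiff_crossCap k)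
      · exact contDiff_eval h
    · rw [fderiv_crossCap hk]
      have h₁' := congrArg (MvPolynomial.eval x) h₁
      have h₂' := congrArg (MvPolynomial.eval x) h₂
      rw [e₁, map_mul] at h₁'
      rw [e₂, map_mul] at h₂'
      funext t
      rcases t with i | i | i
      · rfl
      · rfl
      · fin_cases i
        · simp only [Fin.zero_eta, Sum.elim_inr, Sum.elim_inl, Matrix.cons_val_zero, ← h₁']
          ring
        · simp only [Fin.mk_one, Sum.elim_inr, Sum.elim_inl, Matrix.cons_val_one,
            Matrix.cons_val_zero, ← h₂']
          ring

/-! ### Antisymmetric convolution identities. -/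

section Convolution

variable {R : Type*} [CommRing R]

theorem sum_Icc_sub_reflect (a b : ℤ) (g : ℤ → ℤ → R) :
    ∑ r ∈ Icc a b, (g r (a + b - r) - g (a + b - r) r) = 0 := by
  rw [sum_sub_distrib, sub_eq_zero]
  refine sum_nbij' (fun r => a + b - r) (fun r => a + b - r) ?_ ?_ ?_ ?_ ?_ <;>
    intro r hr <;> simp only [mem_Icc] at hr ⊢
  any_goals omega
  rw [sub_sub_cancel]

/-- For `i ≥ k`, every pair on the antidiagonal with both entries at most `k` lies in the range of
summation; these pairs are stable under the swap, so the antisymmetric summand cancels. This keeps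
the symbols below degree `k` in `y`. -/
theorem antidiag_sum_eq_zero {k m i : ℤ} (hm : 0 ≤ m) (hi : k ≤ i) {g : ℤ → ℤ → R}
    (hg : ∀ r s, k < r ∨ k < s → g r s = 0) :
    ∑ r ∈ Icc 1 i, (g r (m + 1 + i - r) - g (m + 1 + i - r) r) = 0 := by
  have h := sum_Icc_sub_reflect (m + 1 + i - k) k g
  simp only [sub_add_cancel] at h
  rw [← h]
  refine (sum_subset ?_ fun r hr hr' => ?_).symm
  · intro r
    simp only [mem_Icc]
    omega
  · simp only [mem_Icc] at hr hr'
    rw [hg _ _ (by omega), hg _ _ (by omega), sub_zero]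

/-- The sum up to `r = k` over the same antidiagonal vanishes, so stopping at `k - 1` leaves minus
the term `r = k`. -/
theorem antidiag_sum_pred {k m : ℤ} (hm : 1 ≤ m) (hk : m ≤ k) {g : ℤ → ℤ → R}
    (hg : ∀ r s, k < r ∨ k < s → g r s = 0) :
    ∑ r ∈ Icc 1 (k - 1), (g r (m + 1 + (k - 1) - r) - g (m + 1 + (k - 1) - r) r) =
      g m k - g k m := by
  have h := antidiag_sum_eq_zero (m := m - 1) (i := k) (by omega) le_rfl hg
  rw [sum_Icc_split (by omega)] at h
  have e : ∀ r : ℤ, m - 1 + 1 + k - r = m + 1 + (k - 1) - r := fun r => by ring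
  simp only [e] at h
  rw [eq_neg_of_add_eq_zero_left h, show m + 1 + (k - 1) - k = m by ring]
  ring

/-- The bound `r ≤ i` says exactly that the partner index `s = m + 1 + i - r` is at least `m + 1`.
The right side is thus the product of a full sum with a tail, antisymmetrized, with its powers
`y^i`, `i ≥ k`, already cancelled. -/
theorem sum_antidiag_sum_mul_pow {k m : ℤ} (hk : 1 ≤ k) (hm : 0 ≤ m) {g : ℤ → ℤ → R}
    (hg : ∀ r s, k < r ∨ k < s → g r s = 0) (y : R) :
    ∑ i ∈ Icc 0 (k - 1), (∑ r ∈ Icc 1 i, (g r (m + 1 + i - r) - g (m + 1 + i - r) r)) * y ^ i.toNat =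
      ∑ r ∈ Icc 1 k, ∑ s ∈ Icc (m + 1) k, (g r s - g s r) * y ^ (r + s - m - 1).toNat := by
  -- The added coefficients are zero, and `2 * k` bounds every exponent `r + s - m - 1`.
  have h1 : ∑ i ∈ Icc 0 (k - 1),
      (∑ r ∈ Icc 1 i, (g r (m + 1 + i - r) - g (m + 1 + i - r) r)) * y ^ i.toNat =
      ∑ i ∈ Icc 0 (2 * k),
        (∑ r ∈ Icc 1 i, (g r (m + 1 + i - r) - g (m + 1 + i - r) r)) * y ^ i.toNat := by
    refine sum_subset (fun r => ?_) fun i hi hi' => ?_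
    · simp only [mem_Icc]
      omega
    · simp only [mem_Icc] at hi hi'
      rw [antidiag_sum_eq_zero hm (by omega) hg, zero_mul]
  rw [h1]
  simp only [sum_mul]
  rw [sum_sigma', ← sum_product']
  symm
  refine sum_of_injOn (fun p : ℤ × ℤ => (⟨p.1 + p.2 - m - 1, p.1⟩ : (_ : ℤ) × ℤ)) ?_ ?_ ?_ ?_
  · rintro ⟨r, s⟩ - ⟨r', s'⟩ - h
    simp only [Sigma.mk.injEq, heq_eq_eq] at h
    ext <;> simp only <;> omega
  · rintro ⟨r, s⟩ h
    simp only [coe_product, Set.mem_prod, mem_coe, mem_Icc] at h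
    simp only [coe_sigma, Set.mem_sigma_iff, mem_coe, mem_Icc]
    omega
  · rintro ⟨i, r⟩ h h'
    simp only [mem_sigma, mem_Icc] at h
    have : k < r ∨ k < m + 1 + i - r := by
      by_contra! hc
      refine h' ⟨(r, m + 1 + i - r), ?_, ?_⟩
      · simp only [coe_product, Set.mem_prod, mem_coe, mem_Icc]
        omega
      · simp only [Sigma.mk.injEq, heq_eq_eq, and_true]
        ring
    rw [hg _ _ this, hg _ _ this.symm, sub_zero, zero_mul]
  · rintro ⟨r, s⟩ -
    simp only
    rw [show m + 1 + (r + s - m - 1) - r = s by ring]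

theorem sum_shift_mul_pow {k j : ℤ} (hj : 1 ≤ j) {F : ℤ → R} (hF : ∀ s, k < s → F s = 0) (y : R) :
    ∑ i ∈ Icc 0 (k - 1), F (j + i) * y ^ i.toNat = ∑ s ∈ Icc j k, F s * y ^ (s - j).toNat := by
  symm
  refine sum_of_injOn (fun s => s - j) (fun _ _ _ _ h => by simpa using h) ?_ ?_ ?_
  · intro s hs
    simp only [coe_Icc, Set.mem_Icc] at hs ⊢
    omega
  · intro i hi hi'
    simp only [mem_Icc] at hi
    rw [hF _ (by
      by_contra! hc
      refine hi' ⟨j + i, ?_, by ring⟩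
      simp only [coe_Icc, Set.mem_Icc]
      omega), zero_mul]
  · intro s _
    simp only [add_sub_cancel]

theorem sum_Icc_zero {k : ℤ} (hk : 1 ≤ k) (F : ℤ → R) :
    ∑ i ∈ Icc 0 (k - 1), F i = F 0 + ∑ i ∈ Icc 1 (k - 1), F i := by
  have : Icc 0 (k - 1) = insert 0 (Icc 1 (k - 1)) := by
    ext r
    simp only [mem_Icc, mem_insert]
    omega
  rw [this, sum_insert (by simp)]

/-- The common shape of the components of the second and third families. -/
theorem family_identity {k m : ℤ} (hk : 1 ≤ k) (hm : 0 ≤ m) {a b : ℤ → R}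
    (ha : ∀ r, k < r → a r = 0) (hb : ∀ r, k < r → b r = 0) (c y : R) :
    (k * (m + 1) * a (m + 1) * (∑ r ∈ Icc 1 k, b r * y ^ r.toNat) + c * a 1) -
      ∑ i ∈ Icc 1 (k - 1), (-(k * (m + 1 + i) * a (m + 1 + i) * ∑ r ∈ Icc 1 k, b r * y ^ r.toNat)
        + k * (∑ r ∈ Icc 1 i, (((m + 1 + i - r : ℤ) : R) * a (m + 1 + i - r) * b r
            - (r : R) * a r * b (m + 1 + i - r)))
        - c * (i + 1) * a (i + 1)) * y ^ i.toNat =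
      (k * y * (∑ s ∈ Icc (m + 1) k, b s * y ^ (s - m - 1).toNat) + c) *
        ∑ r ∈ Icc 1 k, a r * (r * y ^ (r - 1).toNat) := by
  set w := ∑ r ∈ Icc 1 k, b r * y ^ r.toNat with hw
  -- With this `g` the double sum is `w ∑_{s>m} s a_s y^{s-m-1}` minus `y ∑_{s>m} b_s y^{s-m-1}`
  -- times the derivative of `∑ a_r y^r`; the latter product is the multiplier part of the claim.
  have hconv := sum_antidiag_sum_mul_pow hk hm (g := fun r s => (s : R) * a s * b r)
    (by rintro r s (h | h) <;> simp [ha, hb, h]) y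
  have hq := sum_shift_mul_pow (k := k) (j := m + 1) (by omega) (F := fun s => (s : R) * a s)
    (fun s hs => by simp [ha s hs]) y
  simp only [Int.cast_add, Int.cast_one, ← sub_sub] at hq
  have hd : ∑ i ∈ Icc 0 (k - 1), (i + 1 : R) * a (i + 1) * y ^ i.toNat =
      ∑ r ∈ Icc 1 k, a r * (r * y ^ (r - 1).toNat) := by
    refine sum_nbij' (fun i => i + 1) (fun r => r - 1) ?_ ?_ ?_ ?_ ?_ <;>
      intro r hr <;> simp only [mem_Icc] at hr ⊢
    any_goals omega
    rw [add_sub_cancel_right]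
    push_cast
    ring
  have hprod : ∑ r ∈ Icc 1 k, ∑ s ∈ Icc (m + 1) k,
      ((s : R) * a s * b r - (r : R) * a r * b s) * y ^ (r + s - m - 1).toNat =
      w * (∑ s ∈ Icc (m + 1) k, (s : R) * a s * y ^ (s - m - 1).toNat) -
        y * (∑ s ∈ Icc (m + 1) k, b s * y ^ (s - m - 1).toNat) *
          ∑ r ∈ Icc 1 k, a r * (r * y ^ (r - 1).toNat) := by
    rw [hw, sum_mul_sum, mul_assoc, mul_comm (∑ s ∈ _, b s * _), sum_mul_sum, mul_sum,
      ← sum_sub_distrib]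
    refine sum_congr rfl fun r hr => ?_
    rw [mul_sum, ← sum_sub_distrib]
    refine sum_congr rfl fun s hs => ?_
    simp only [mem_Icc] at hr hs
    obtain ⟨p, hp⟩ : ∃ p : ℕ, r = p + 1 := ⟨(r - 1).toNat, by omega⟩
    obtain ⟨q, hq⟩ : ∃ q : ℕ, s = q + m + 1 := ⟨(s - m - 1).toNat, by omega⟩
    rw [show (r + s - m - 1).toNat = p + 1 + q by omega, show r.toNat = p + 1 by omega,
      show (r - 1).toNat = p by omega, show (s - m - 1).toNat = q by omega]
    ring
  rw [hprod] at hconv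
  clear_value w
  have hD : ∑ i ∈ Icc 1 (k - 1),
      (-(k * (m + 1 + i) * a (m + 1 + i) * w)
        + k * (∑ r ∈ Icc 1 i, (((m + 1 + i - r : ℤ) : R) * a (m + 1 + i - r) * b r
            - (r : R) * a r * b (m + 1 + i - r)))
        - c * (i + 1) * a (i + 1)) * y ^ i.toNat =
      -(k * w * ∑ i ∈ Icc 1 (k - 1), (m + 1 + i : R) * a (m + 1 + i) * y ^ i.toNat)
      + k * (∑ i ∈ Icc 1 (k - 1), (∑ r ∈ Icc 1 i, (((m + 1 + i - r : ℤ) : R) *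
          a (m + 1 + i - r) * b r - (r : R) * a r * b (m + 1 + i - r))) * y ^ i.toNat)
      - c * ∑ i ∈ Icc 1 (k - 1), (i + 1 : R) * a (i + 1) * y ^ i.toNat := by
    rw [mul_sum, mul_sum, mul_sum, ← sum_neg_distrib, ← sum_add_distrib, ← sum_sub_distrib]
    exact sum_congr rfl fun i _ => by ring
  -- The terms `i = 0` are what the `C`-component contributes.
  rw [sum_Icc_zero hk] at hconv hq hd
  simp only [Int.cast_zero, add_zero, zero_add, Int.toNat_zero, pow_zero, mul_one, one_mul,
    show Icc (1 : ℤ) 0 = ∅ from rfl, sum_empty] at hconv hq hd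
  rw [hD, hconv, ← hd, ← hq]
  ring

/-- The last component of the second and third families vanishes. -/
theorem family_last {k m : ℤ} (hm : 1 ≤ m) (hk : m ≤ k) {a b : ℤ → R}
    (ha : ∀ r, k < r → a r = 0) (hb : ∀ r, k < r → b r = 0) (c w : R) :
    -(k * (m + 1 + (k - 1)) * a (m + 1 + (k - 1)) * w)
        + k * (∑ r ∈ Icc 1 (k - 1), (((m + 1 + (k - 1) - r : ℤ) : R) * a (m + 1 + (k - 1) - r) * b r
            - (r : R) * a r * b (m + 1 + (k - 1) - r)))
        - c * ((k - 1) + 1) * a (k - 1 + 1) = k * (k * a k * b m - m * a m * b k - c * a k) := by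
  rw [antidiag_sum_pred hm hk (g := fun r s => (s : R) * a s * b r)
    (by rintro r s (h | h) <;> simp [ha, hb, h]), ha _ (by omega), sub_add_cancel]
  ring_nf

/-- There is no coordinate `U_{k-1}`, so the `A`-components stop at `k - 2` and `c` must kill the
coefficient of `y^{k-1}`. With `a = u` this forces `c = (k - m) u_m` for `b = u` and `c = k v_m` for
`b = v`: the origin of the constants `j` and `k` in the second and third families. -/
theorem family_identity_of_last {k m : ℤ} (hm : 1 ≤ m) (hk : m + 1 ≤ k) {a b : ℤ → R}
    (ha : ∀ r, k < r → a r = 0) (hb : ∀ r, k < r → b r = 0) (c y : R)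
    (hlast : k * a k * b m - m * a m * b k - c * a k = 0) :
    (k * (m + 1) * a (m + 1) * (∑ r ∈ Icc 1 k, b r * y ^ r.toNat) + c * a 1) -
      ∑ i ∈ Icc 1 (k - 2), (-(k * (m + 1 + i) * a (m + 1 + i) * ∑ r ∈ Icc 1 k, b r * y ^ r.toNat)
        + k * (∑ r ∈ Icc 1 i, (((m + 1 + i - r : ℤ) : R) * a (m + 1 + i - r) * b r
            - (r : R) * a r * b (m + 1 + i - r)))
        - c * (i + 1) * a (i + 1)) * y ^ i.toNat =
      (k * y * (∑ s ∈ Icc (m + 1) k, b s * y ^ (s - m - 1).toNat) + c) *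
        ∑ r ∈ Icc 1 k, a r * (r * y ^ (r - 1).toNat) := by
  have hL := family_last hm (by omega) ha hb c (∑ r ∈ Icc 1 k, b r * y ^ r.toNat)
  rw [hlast, mul_zero] at hL
  rw [← family_identity (by omega) (by omega) ha hb c y, sum_Icc_split (b := k - 1) (by omega),
    show k - 1 - 1 = k - 2 by ring]
  simp only [Int.cast_sub, Int.cast_one] at hL ⊢
  rw [hL, zero_mul, add_zero]

/-- The shape of the last component of the first family. -/
theorem first_family_identity {k j : ℤ} (hj : 1 ≤ j) (hk : j ≤ k) {a b : ℤ → R}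
    (ha : ∀ r, k < r → a r = 0) (hb : ∀ r, k ≤ r → b r = 0) (y : R) :
    (-(k * b j * (∑ r ∈ Icc 1 k, a r * y ^ r.toNat))
        + (k - j) * a j * ∑ r ∈ Icc 1 k, b r * y ^ r.toNat) -
      ∑ i ∈ Icc 1 (k - 1), (k * (∑ r ∈ Icc 1 (i - 1), a (i + j - r) * b r)
        - k * (∑ r ∈ Icc 1 i, a r * b (i + j - r))
        - (i - 1) * (k - j) * a j * b i
        + k * b (i + j) * (∑ r ∈ Icc 1 k, a r * y ^ r.toNat)
        - k * a (i + j) * ∑ r ∈ Icc 1 k, b r * y ^ r.toNat) * y ^ i.toNat =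
      ((k - j) * a j * y) * ∑ r ∈ Icc 1 k, b r * (r * y ^ (r - 1).toNat) := by
  have hk1 : 1 ≤ k := hj.trans hk
  set α := ∑ r ∈ Icc 1 k, a r * y ^ r.toNat with hα
  set β := ∑ r ∈ Icc 1 k, b r * y ^ r.toNat with hβ
  have hb' : ∀ r, k < r → b r = 0 := fun r hr => hb r hr.le
  -- The terms with factor `k` in the claim are `k` times this relation between `α` and `β` and
  -- contribute zero; the terms with factor `(k - j) a_j` assemble to `(k - j) a_j y Q'`.
  have hconv := sum_antidiag_sum_mul_pow hk1 (m := j - 1) (by omega) (g := fun r s => a s * b r)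
    (by rintro r s (h | h) <;> simp [ha, hb', h]) y
  have ha' := sum_shift_mul_pow hj ha y
  have hb'' := sum_shift_mul_pow hj hb' y
  have hprod : ∑ r ∈ Icc 1 k, ∑ s ∈ Icc (j - 1 + 1) k,
      (a s * b r - a r * b s) * y ^ (r + s - (j - 1) - 1).toNat =
      β * (∑ s ∈ Icc j k, a s * y ^ (s - j).toNat) -
        α * (∑ s ∈ Icc j k, b s * y ^ (s - j).toNat) := by
    rw [hα, hβ, sum_mul_sum, sum_mul_sum, ← sum_sub_distrib, sub_add_cancel]
    refine sum_congr rfl fun r hr => ?_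
    rw [← sum_sub_distrib]
    refine sum_congr rfl fun s hs => ?_
    simp only [mem_Icc] at hr hs
    rw [show (r + s - (j - 1) - 1).toNat = r.toNat + (s - j).toNat by omega]
    ring
  have hβ' : β = ∑ i ∈ Icc 1 (k - 1), b i * y ^ i.toNat := by
    rw [hβ, sum_Icc_split hk1, hb k le_rfl, zero_mul, add_zero]
  have hQ : y * ∑ r ∈ Icc 1 k, b r * (r * y ^ (r - 1).toNat) =
      (∑ i ∈ Icc 1 (k - 1), (i - 1) * b i * y ^ i.toNat) + β := by
    rw [hβ', sum_Icc_split hk1, hb k le_rfl, zero_mul, add_zero, mul_sum, ← sum_add_distrib]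
    refine sum_congr rfl fun i hi => ?_
    simp only [mem_Icc] at hi
    rw [show i.toNat = (i - 1).toNat + 1 by omega]
    ring
  clear_value α
  rw [hprod] at hconv
  have hD : ∑ i ∈ Icc 1 (k - 1), (k * (∑ r ∈ Icc 1 (i - 1), a (i + j - r) * b r)
        - k * (∑ r ∈ Icc 1 i, a r * b (i + j - r))
        - (i - 1) * (k - j) * a j * b i + k * b (i + j) * α - k * a (i + j) * β) * y ^ i.toNat =
      k * (∑ i ∈ Icc 1 (k - 1), (∑ r ∈ Icc 1 i, (a (j - 1 + 1 + i - r) * b r -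
        a r * b (j - 1 + 1 + i - r))) * y ^ i.toNat)
      - k * a j * (∑ i ∈ Icc 1 (k - 1), b i * y ^ i.toNat)
      - (k - j) * a j * (∑ i ∈ Icc 1 (k - 1), (i - 1) * b i * y ^ i.toNat)
      + k * α * (∑ i ∈ Icc 1 (k - 1), b (j + i) * y ^ i.toNat)
      - k * β * (∑ i ∈ Icc 1 (k - 1), a (j + i) * y ^ i.toNat) := by
    clear_value β
    rw [mul_sum, mul_sum, mul_sum, mul_sum, mul_sum, ← sum_sub_distrib, ← sum_sub_distrib,
      ← sum_add_distrib, ← sum_sub_distrib]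
    refine sum_congr rfl fun i hi => ?_
    simp only [mem_Icc] at hi
    -- The first sum of the family stops at `i - 1`; its missing term `a_j b_i` is restored and
    -- compensated by `-k a_j ∑ b_i y^i`.
    rw [sum_sub_distrib, sub_add_cancel, add_comm j i, sum_Icc_split hi.1 (fun r => _ * b r),
      add_sub_cancel_left]
    ring
  rw [sum_Icc_zero hk1] at hconv ha' hb''
  simp only [add_zero, Int.toNat_zero, pow_zero, mul_one, zero_add,
    show Icc (1 : ℤ) 0 = ∅ from rfl, sum_empty] at hconv ha' hb''
  rw [hD, hconv, ← ha', ← hb'', ← hβ', mul_assoc _ y, hQ]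
  ring

end Convolution

/-! ### The generators are liftable. -/

theorem symb₁_tuple {k : ℕ} (hk : 2 ≤ k) (A B : ℤ → TgtRing k) (C₁ C₂ : TgtRing k) :
    symb₁ (tuple k A B C₁ C₂) =
      pullback k C₁ - ∑ i ∈ Icc 1 ((k : ℤ) - 2), pullback k (A i) * Y k ^ i.toNat := by
  rw [← sum_fin_eq_sum_Icc (k - 2) _ (by omega) fun i => pullback k (A i) * Y k ^ i.toNat]
  simp [symb₁, tuple]

theorem symb₂_tuple {k : ℕ} (hk : 2 ≤ k) (A B : ℤ → TgtRing k) (C₁ C₂ : TgtRing k) :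
    symb₂ (tuple k A B C₁ C₂) =
      pullback k C₂ - ∑ i ∈ Icc 1 ((k : ℤ) - 1), pullback k (B i) * Y k ^ i.toNat := by
  rw [← sum_fin_eq_sum_Icc (k - 1) _ (by omega) fun i => pullback k (B i) * Y k ^ i.toNat]
  simp [symb₂, tuple]

theorem pullback_U (k : ℕ) (r : ℤ) : pullback k (U k r) = uSeq k r := rfl

theorem pullback_V (k : ℕ) (r : ℤ) : pullback k (V k r) = vSeq k r := rfl

theorem Y_mul_dP {k : ℕ} : Y k * dP k = ∑ r ∈ Icc 1 (k : ℤ), r * uSeq k r * Y k ^ r.toNat := by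
  rw [dP, mul_sum]
  refine sum_congr rfl fun r hr => ?_
  simp only [mem_Icc] at hr
  rw [show r.toNat = (r - 1).toNat + 1 by omega]
  ring

theorem Y_mul_dQ {k : ℕ} : Y k * dQ k = ∑ r ∈ Icc 1 (k : ℤ), r * vSeq k r * Y k ^ r.toNat := by
  rw [dQ, mul_sum]
  refine sum_congr rfl fun r hr => ?_
  simp only [mem_Icc] at hr
  rw [show r.toNat = (r - 1).toNat + 1 by omega]
  ring

/-- Euler's relation for `P`; the indices `k - 1` and `k` drop out because `u_{k-1} = 0` and `k - i
= 0` at `i = k`. -/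
theorem sum_uSeq_trunc {k : ℕ} (hk : 2 ≤ k) :
    k * pullback k (W₁ k) - ∑ i ∈ Icc 1 ((k : ℤ) - 2), ((k : SrcRing k) - i) * uSeq k i * Y k ^ i.toNat =
      Y k * dP k := by
  have h : ∑ i ∈ Icc 1 ((k : ℤ) - 2), ((k : SrcRing k) - i) * uSeq k i * Y k ^ i.toNat =
      ∑ i ∈ Icc 1 (k : ℤ), ((k : SrcRing k) - i) * uSeq k i * Y k ^ i.toNat := by
    rw [sum_Icc_split (b := (k : ℤ)) (by omega), sum_Icc_split (b := (k : ℤ) - 1) (by omega),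
      uSeq_pred, show (k : ℤ) - 1 - 1 = k - 2 by ring]
    simp
  rw [h, Y_mul_dP, pullback_W₁ hk, mul_sum, ← sum_sub_distrib]
  exact sum_congr rfl fun r _ => by ring

theorem sum_vSeq_trunc {k : ℕ} (hk : 2 ≤ k) :
    k * pullback k (W₂ k) - ∑ i ∈ Icc 1 ((k : ℤ) - 1), ((k : SrcRing k) - i) * vSeq k i * Y k ^ i.toNat =
      Y k * dQ k := by
  have h : ∑ i ∈ Icc 1 ((k : ℤ) - 1), ((k : SrcRing k) - i) * vSeq k i * Y k ^ i.toNat =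
      ∑ i ∈ Icc 1 (k : ℤ), ((k : SrcRing k) - i) * vSeq k i * Y k ^ i.toNat := by
    rw [sum_Icc_split (b := (k : ℤ)) (by omega)]
    simp
  rw [h, Y_mul_dQ, pullback_W₂ hk, mul_sum, ← sum_sub_distrib]
  exact sum_congr rfl fun r _ => by ring

theorem eulerField_mem {k : ℕ} (hk : 2 ≤ k) :
    eulerField k ∈ liftablePolyFields (crossCap k) (contDiff_crossCap k) := by
  rw [mem_liftable_iff hk]
  refine ⟨Y k, ?_, ?_⟩
  · rw [eulerField, symb₁_tuple hk, ← sum_uSeq_trunc hk]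
    simp [pullback_U]
  · rw [eulerField, symb₂_tuple hk, ← sum_vSeq_trunc hk]
    simp [pullback_V]

/-- The multiplier is that of `(k - j) U_j ξ_e`, with which `ξ^1_j` shares its `A`- and
`C_1`-components. -/
theorem xi₁_mem {k : ℕ} (hk : 2 ≤ k) {j : ℤ} (hj : 1 ≤ j) (hjk : j ≤ k - 1) :
    xi₁ k j ∈ liftablePolyFields (crossCap k) (contDiff_crossCap k) := by
  rw [mem_liftable_iff hk]
  refine ⟨(k - j) * uSeq k j * Y k, ?_, ?_⟩
  · rw [xi₁, symb₁_tuple hk, mul_assoc _ (Y k), ← sum_uSeq_trunc hk, mul_sub (_ * _),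
      mul_sum _ _ (_ * uSeq k j)]
    refine congrArg₂ (· - ·) ?_ ?_
    · simp only [map_mul, map_intCast, pullback_U]
      push_cast
      ring
    · refine sum_congr rfl fun i _ => ?_
      simp only [map_mul, map_intCast, pullback_U]
      push_cast
      ring
  · have h := first_family_identity (k := k) hj (by omega) (a := uSeq k) (b := vSeq k)
      (fun r hr => uSeq_of_gt hr) (fun r hr => vSeq_of_ge hr) (Y k)
    simp only [Int.cast_natCast, ← pullback_W₁ hk, ← pullback_W₂ hk] at h
    rw [xi₁, symb₂_tuple hk, dQ, ← h]
    simp only [map_mul, map_add, map_sub, map_neg, map_sum, map_intCast, map_natCast, pullback_U,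
      pullback_V, Int.cast_sub, Int.cast_mul, Int.cast_natCast,
      Int.cast_one, map_one]

theorem xi₂_mem {k : ℕ} (hk : 2 ≤ k) {j : ℤ} (hj : 1 ≤ j) (hjk : j ≤ k - 1) :
    xi₂ k j ∈ liftablePolyFields (crossCap k) (contDiff_crossCap k) := by
  rw [mem_liftable_iff hk]
  have e₁ (i : ℤ) : (k : ℤ) + i - j + 1 = k - j + 1 + i := by ring
  have e₂ (i r : ℤ) : (k : ℤ) + i - j - r + 1 = k - j + 1 + i - r := by ring
  -- With `m = k - j`, the multiplier is `k y` times the tail of `P` above degree `m`, divided by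
  -- `y^{m+1}`, plus the constant forced by the missing `U_{k-1}`.
  refine ⟨k * Y k * (∑ s ∈ Icc ((k : ℤ) - j + 1) k, uSeq k s * Y k ^ (s - (k - j) - 1).toNat) +
    j * uSeq k (k - j), ?_, ?_⟩
  · have h := family_identity_of_last (k := k) (m := k - j) (by omega) (by omega) (a := uSeq k)
      (b := uSeq k) (fun r hr => uSeq_of_gt hr) (fun r hr => uSeq_of_gt hr) (j * uSeq k (k - j)) (Y k)
      (by rw [uSeq_top]; push_cast; ring)
    simp only [Int.cast_natCast, ← pullback_W₁ hk] at h
    rw [xi₂, symb₁_tuple hk, dP, ← h]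
    simp only [map_mul, map_add, map_sub, map_neg, map_sum, map_intCast, map_natCast, pullback_U,
      e₁, e₂]
    refine congrArg₂ (· - ·) ?_ (sum_congr rfl fun i _ => ?_)
    · push_cast
      ring
    · refine congrArg (· * Y k ^ i.toNat) ?_
      have hs : ∑ r ∈ Icc 1 i, ((k - j + 1 + i - 2 * r : ℤ) : SrcRing k) * uSeq k r *
          uSeq k (k - j + 1 + i - r) = ∑ r ∈ Icc 1 i, (((k - j + 1 + i - r : ℤ) : SrcRing k) *
            uSeq k (k - j + 1 + i - r) * uSeq k r - (r : SrcRing k) * uSeq k r *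
            uSeq k (k - j + 1 + i - r)) :=
        sum_congr rfl fun r _ => by push_cast; ring
      rw [hs]
      push_cast
      ring
  -- `V_{k-1}` is a coordinate, so the `B`-components reach `k - 1` and impose no condition on the
  -- constant.
  · have h := family_identity (k := k) (m := k - j) (by omega) (by omega) (a := vSeq k)
      (b := uSeq k) (fun r hr => vSeq_of_ge hr.le) (fun r hr => uSeq_of_gt hr)
      (j * uSeq k (k - j)) (Y k)
    simp only [Int.cast_natCast, ← pullback_W₁ hk] at h
    rw [xi₂, symb₂_tuple hk, dQ, ← h]
    simp only [map_mul, map_add, map_sub, map_neg, map_sum, map_intCast, map_natCast, pullback_U,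
      pullback_V, e₁, e₂]
    refine congrArg₂ (· - ·) ?_ (sum_congr rfl fun i _ => ?_)
    · push_cast
      ring
    · refine congrArg (· * Y k ^ i.toNat) ?_
      have hs : ∑ r ∈ Icc 1 i, (((k - j + 1 + i - r : ℤ) : SrcRing k) *
            vSeq k (k - j + 1 + i - r) * uSeq k r - (r : SrcRing k) * vSeq k r *
            uSeq k (k - j + 1 + i - r)) = (∑ r ∈ Icc 1 i, ((k - j + 1 + i - r : ℤ) : SrcRing k) *
            uSeq k r * vSeq k (k - j + 1 + i - r)) - ∑ r ∈ Icc 1 i, (r : SrcRing k) *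
            uSeq k (k - j + 1 + i - r) * vSeq k r := by
        rw [← sum_sub_distrib]
        exact sum_congr rfl fun r _ => by ring
      rw [hs]
      push_cast
      ring

theorem xi₃_mem {k : ℕ} (hk : 2 ≤ k) {j : ℤ} (hj : 1 ≤ j) (hjk : j ≤ k - 1) :
    xi₃ k j ∈ liftablePolyFields (crossCap k) (contDiff_crossCap k) := by
  rw [mem_liftable_iff hk]
  have e₁ (i : ℤ) : (k : ℤ) + i - j + 1 = k - j + 1 + i := by ring
  have e₂ (i r : ℤ) : (k : ℤ) + i - j - r + 1 = k - j + 1 + i - r := by ring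
  refine ⟨k * Y k * (∑ s ∈ Icc ((k : ℤ) - j + 1) k, vSeq k s * Y k ^ (s - (k - j) - 1).toNat) +
    k * vSeq k (k - j), ?_, ?_⟩
  · have h := family_identity_of_last (k := k) (m := k - j) (by omega) (by omega) (a := uSeq k)
      (b := vSeq k) (fun r hr => uSeq_of_gt hr) (fun r hr => vSeq_of_ge hr.le)
      (k * vSeq k (k - j)) (Y k)
      (by rw [uSeq_top, vSeq_of_ge le_rfl]; push_cast; ring)
    simp only [Int.cast_natCast, ← pullback_W₂ hk] at h
    rw [xi₃, symb₁_tuple hk, dP, ← h]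
    simp only [map_mul, map_add, map_sub, map_neg, map_sum, map_intCast, map_natCast, pullback_U,
      pullback_V, e₁, e₂]
    refine congrArg₂ (· - ·) ?_ (sum_congr rfl fun i _ => ?_)
    · push_cast
      ring
    · refine congrArg (· * Y k ^ i.toNat) ?_
      rw [sum_sub_distrib]
      push_cast
      ring
  · have h := family_identity (k := k) (m := k - j) (by omega) (by omega) (a := vSeq k)
      (b := vSeq k) (fun r hr => vSeq_of_ge hr.le) (fun r hr => vSeq_of_ge hr.le)
      (k * vSeq k (k - j)) (Y k)
    simp only [Int.cast_natCast, ← pullback_W₂ hk] at h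
    rw [xi₃, symb₂_tuple hk, dQ, ← h]
    simp only [map_mul, map_add, map_sub, map_neg, map_sum, map_intCast, map_natCast, pullback_V,
      e₁, e₂]
    refine congrArg₂ (· - ·) ?_ (sum_congr rfl fun i _ => ?_)
    · push_cast
      ring
    · refine congrArg (· * Y k ^ i.toNat) ?_
      have hs : ∑ r ∈ Icc 1 i, ((k - j + 1 + i - 2 * r : ℤ) : SrcRing k) * vSeq k r *
          vSeq k (k - j + 1 + i - r) = ∑ r ∈ Icc 1 i, (((k - j + 1 + i - r : ℤ) : SrcRing k) *
            vSeq k (k - j + 1 + i - r) * vSeq k r - (r : SrcRing k) * vSeq k r *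
            vSeq k (k - j + 1 + i - r)) :=
        sum_congr rfl fun r _ => by push_cast; ring
      rw [hs]
      push_cast
      ring

theorem span_generators_le {k : ℕ} (hk : 2 ≤ k) :
    Submodule.span (TgtRing k) (generators k) ≤
      liftablePolyFields (crossCap k) (contDiff_crossCap k) := by
  refine Submodule.span_le.2 ?_
  rintro ξ (hξ | hξ)
  · rw [Set.mem_singleton_iff.1 hξ]
    exact eulerField_mem hk
  · simp only [Set.mem_iUnion] at hξ
    obtain ⟨j, ⟨hj, hjk⟩, hξ⟩ := hξ
    rcases hξ with rfl | rfl | rfl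
    exacts [xi₁_mem hk hj hjk, xi₂_mem hk hj hjk, xi₃_mem hk hj hjk]

/-! ### Normal forms modulo a submodule, with coefficients in a subring. -/

section Reduction

variable {S M : Type*} [CommRing S] [AddCommGroup M] [Module S M]

/-- Elements congruent modulo `G` to an `R`-linear combination of `e 0, …, e (n - 1)`. -/
def reduced (R : Subring S) (G : Submodule S M) (n : ℕ) (e : ℕ → M) : Submodule R M :=
  G.restrictScalars R ⊔ Submodule.span R (Set.range fun i : Fin n => e i)

variable {R : Subring S} {G : Submodule S M} {n : ℕ} {e : ℕ → M}

theorem mem_reduced_of_mem {x : M} (hx : x ∈ G) : x ∈ reduced R G n e :=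
  Submodule.mem_sup_left hx

theorem basis_mem_reduced {a : ℕ} (ha : a < n) : e a ∈ reduced R G n e :=
  Submodule.mem_sup_right (Submodule.subset_span ⟨⟨a, ha⟩, rfl⟩)

theorem smul_mem_reduced {r : S} (hr : r ∈ R) {x : M} (hx : x ∈ reduced R G n e) :
    r • x ∈ reduced R G n e :=
  (reduced R G n e).smul_mem ⟨r, hr⟩ hx

theorem sum_smul_mem_reduced {c : ℕ → S} (hc : ∀ i, c i ∈ R) :
    ∑ i ∈ range n, c i • e i ∈ reduced R G n e :=
  Submodule.sum_mem _ fun i hi => smul_mem_reduced (hc i) (basis_mem_reduced (mem_range.1 hi))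

theorem exists_of_mem_reduced {x : M} (hx : x ∈ reduced R G n e) :
    ∃ g ∈ G, ∃ c : Fin n → S, (∀ i, c i ∈ R) ∧ x = g + ∑ i, c i • e i := by
  obtain ⟨g, hg, z, hz, rfl⟩ := Submodule.mem_sup.1 hx
  obtain ⟨c, rfl⟩ := Submodule.mem_span_range_iff_exists_fun R |>.1 hz
  exact ⟨g, hg, fun i => c i, fun i => (c i).2, rfl⟩

/-- Multiplication by `w` preserves the reduced elements if it does so for a family that is
triangular with respect to `e`. -/
theorem smul_mem_reduced_of_triangular {w : S}
    (hw : ∀ a < n, ∃ b : ℕ → S, (∀ i, b i ∈ R) ∧ (∃ b' ∈ R, b' * b a = 1) ∧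
      w • ∑ i ∈ range (a + 1), b i • e i ∈ reduced R G n e) {x : M} (hx : x ∈ reduced R G n e) :
    w • x ∈ reduced R G n e := by
  have key : ∀ a < n, w • e a ∈ reduced R G n e := by
    intro a
    induction a using Nat.strong_induction_on with
    -- The diagonal entry `b a` is a unit of `R`, so `w • e a` can be solved for in terms of `w • e
    -- i` with `i < a`.
    | _ a ih =>
      intro ha
      obtain ⟨b, hb, ⟨b', hb', h1⟩, h⟩ := hw a ha
      rw [sum_range_succ, smul_add] at h
      have h2 : w • ∑ i ∈ range a, b i • e i ∈ reduced R G n e := by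
        rw [smul_sum]
        refine Submodule.sum_mem _ fun i hi => ?_
        rw [smul_comm]
        have := mem_range.1 hi
        exact smul_mem_reduced (hb i) (ih i this (this.trans ha))
      have h3 := smul_mem_reduced hb' ((Submodule.add_mem_iff_right _ h2).1 h)
      rwa [smul_comm w, smul_smul, h1, one_smul] at h3
  obtain ⟨g, hg, c, hc, rfl⟩ := exists_of_mem_reduced hx
  rw [smul_add, smul_sum]
  refine add_mem (mem_reduced_of_mem (G.smul_mem _ hg)) (Submodule.sum_mem _ fun i _ => ?_)
  rw [smul_comm]
  exact smul_mem_reduced (hc i) (key i i.2)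

end Reduction

/-! ### Componentwise calculus and the fields with monomial symbols. -/

section Tuple

variable {α : Type*}

theorem tuple_add [Add α] (k : ℕ) (A B A' B' : ℤ → α) (c d c' d' : α) :
    tuple k A B c d + tuple k A' B' c' d' =
      tuple k (fun i => A i + A' i) (fun i => B i + B' i) (c + c') (d + d') := by
  funext t
  rcases t with i | i | i
  · rfl
  · rfl
  · fin_cases i <;> rfl

theorem tuple_sub [Sub α] (k : ℕ) (A B A' B' : ℤ → α) (c d c' d' : α) :
    tuple k A B c d - tuple k A' B' c' d' =
      tuple k (fun i => A i - A' i) (fun i => B i - B' i) (c - c') (d - d') := by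
  funext t
  rcases t with i | i | i
  · rfl
  · rfl
  · fin_cases i <;> rfl

theorem smul_tuple [Mul α] (k : ℕ) (p : α) (A B : ℤ → α) (c d : α) :
    p • tuple k A B c d = tuple k (fun i => p * A i) (fun i => p * B i) (p * c) (p * d) := by
  funext t
  rcases t with i | i | i
  · rfl
  · rfl
  · fin_cases i <;> rfl

theorem tuple_congr {k : ℕ} {A B A' B' : ℤ → α} {c d c' d' : α}
    (hA : ∀ i, 1 ≤ i → i ≤ (k : ℤ) - 2 → A i = A' i)
    (hB : ∀ i, 1 ≤ i → i ≤ (k : ℤ) - 1 → B i = B' i) (hc : c = c') (hd : d = d') :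
    tuple k A B c d = tuple k A' B' c' d' := by
  subst hc hd
  funext t
  rcases t with i | i | i
  · have := i.2
    exact hA _ (by omega) (by omega)
  · have := i.2
    exact hB _ (by omega) (by omega)
  · rfl

end Tuple

/-- The vector field with `C_1 - ∑ A_i y^i = y^a` and the other components zero. -/
def basis₁ (k : ℕ) (a : ℕ) : PolyField (Tgt k) :=
  tuple k (fun i => if i = a then -1 else 0) 0 (if a = 0 then 1 else 0) 0

/-- The vector field with `C_2 - ∑ B_i y^i = y^a` and the other components zero. -/
def basis₂ (k : ℕ) (a : ℕ) : PolyField (Tgt k) :=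
  tuple k 0 (fun i => if i = a then -1 else 0) 0 (if a = 0 then 1 else 0)

theorem sum_smul_basis₁ {k : ℕ} (hk : 2 ≤ k) (c : ℤ → TgtRing k) :
    ∑ a ∈ range (k - 1), c a • basis₁ k a = tuple k (fun i => -c i) 0 (c 0) 0 := by
  funext t
  rw [Finset.sum_apply]
  rcases t with i | i | i
  · rw [sum_eq_single ((i : ℕ) + 1)]
    · simp [basis₁, tuple]
    · intro b _ hb
      have : ¬ ((i : ℤ) + 1 = b) := by omega
      simp [basis₁, tuple, this]
    · intro h
      have := i.2
      simp only [mem_range] at h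
      omega
  · simp [basis₁, tuple]
  · fin_cases i
    · rw [sum_eq_single 0]
      · simp [basis₁, tuple]
      · intro b _ hb
        simp [basis₁, tuple, hb]
      · simp
        omega
    · simp [basis₁, tuple]

theorem sum_smul_basis₂ {k : ℕ} (hk : 2 ≤ k) (c : ℤ → TgtRing k) :
    ∑ a ∈ range k, c a • basis₂ k a = tuple k 0 (fun i => -c i) 0 (c 0) := by
  funext t
  rw [Finset.sum_apply]
  rcases t with i | i | i
  · simp [basis₂, tuple]
  · rw [sum_eq_single ((i : ℕ) + 1)]
    · simp [basis₂, tuple]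
    · intro b _ hb
      have : ¬ ((i : ℤ) + 1 = b) := by omega
      simp [basis₂, tuple, this]
    · intro h
      have := i.2
      simp only [mem_range] at h
      omega
  · fin_cases i
    · simp [basis₂, tuple]
    · rw [sum_eq_single 0]
      · simp [basis₂, tuple]
      · intro b _ hb
        simp [basis₂, tuple, hb]
      · simp
        omega

theorem symb₁_add {k : ℕ} (ξ ζ : PolyField (Tgt k)) : symb₁ (ξ + ζ) = symb₁ ξ + symb₁ ζ := by
  simp only [symb₁, Pi.add_apply, map_add, add_mul, sum_add_distrib]
  ring

theorem symb₂_add {k : ℕ} (ξ ζ : PolyField (Tgt k)) : symb₂ (ξ + ζ) = symb₂ ξ + symb₂ ζ := by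
  simp only [symb₂, Pi.add_apply, map_add, add_mul, sum_add_distrib]
  ring

theorem symb₁_smul {k : ℕ} (p : TgtRing k) (ξ : PolyField (Tgt k)) :
    symb₁ (p • ξ) = pullback k p * symb₁ ξ := by
  simp only [symb₁, Pi.smul_apply, smul_eq_mul, map_mul, mul_sub, mul_sum, mul_assoc]

theorem symb₂_smul {k : ℕ} (p : TgtRing k) (ξ : PolyField (Tgt k)) :
    symb₂ (p • ξ) = pullback k p * symb₂ ξ := by
  simp only [symb₂, Pi.smul_apply, smul_eq_mul, map_mul, mul_sub, mul_sum, mul_assoc]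

theorem symb₁_sum_smul {k n : ℕ} (c : Fin n → TgtRing k) (e : ℕ → PolyField (Tgt k)) :
    symb₁ (∑ i, c i • e i) = ∑ i, pullback k (c i) * symb₁ (e i) := by
  simp only [← symb₁_smul]
  exact map_sum (AddMonoidHom.mk' (symb₁ (k := k)) symb₁_add) _ _

theorem symb₂_sum_smul {k n : ℕ} (c : Fin n → TgtRing k) (e : ℕ → PolyField (Tgt k)) :
    symb₂ (∑ i, c i • e i) = ∑ i, pullback k (c i) * symb₂ (e i) := by
  simp only [← symb₂_smul]
  exact map_sum (AddMonoidHom.mk' (symb₂ (k := k)) symb₂_add) _ _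

theorem symb₁_basis₁ {k a : ℕ} (hk : 2 ≤ k) (ha : a < k - 1) : symb₁ (basis₁ k a) = Y k ^ a := by
  rw [basis₁, symb₁_tuple hk]
  rcases Nat.eq_zero_or_pos a with rfl | h
  · rw [sum_eq_zero]
    · simp
    · intro i hi
      simp only [mem_Icc] at hi
      rw [if_neg (by simp; omega), map_zero, zero_mul]
  · rw [sum_eq_single (a : ℤ)]
    · simp [h.ne']
    · intro b _ hb
      simp [hb]
    · intro h'
      simp only [mem_Icc] at h'
      omega

theorem symb₂_basis₂ {k a : ℕ} (hk : 2 ≤ k) (ha : a < k) : symb₂ (basis₂ k a) = Y k ^ a := by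
  rw [basis₂, symb₂_tuple hk]
  rcases Nat.eq_zero_or_pos a with rfl | h
  · rw [sum_eq_zero]
    · simp
    · intro i hi
      simp only [mem_Icc] at hi
      rw [if_neg (by simp; omega), map_zero, zero_mul]
  · rw [sum_eq_single (a : ℤ)]
    · simp [h.ne']
    · intro b _ hb
      simp [hb]
    · intro h'
      simp only [mem_Icc] at h'
      omega

theorem symb₁_basis₂ {k a : ℕ} (hk : 2 ≤ k) : symb₁ (basis₂ k a) = 0 := by
  rw [basis₂, symb₁_tuple hk]
  simp

/-- The fields with `A = 0` and `C_1 = 0`. -/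
def verticalFields (k : ℕ) : Submodule (TgtRing k) (PolyField (Tgt k)) where
  carrier := {ξ | (∀ i, ξ (Sum.inl i) = 0) ∧ ξ (Sum.inr (Sum.inr 0)) = 0}
  zero_mem' := ⟨fun _ => rfl, rfl⟩
  add_mem' h h' := ⟨fun i => by simp [h.1 i, h'.1 i], by simp [h.2, h'.2]⟩
  smul_mem' p ξ h := ⟨fun i => by simp [h.1 i], by simp [h.2]⟩

theorem symb₁_of_mem_vertical {k : ℕ} {ξ : PolyField (Tgt k)} (h : ξ ∈ verticalFields k) :
    symb₁ ξ = 0 := by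
  simp [symb₁, h.1, h.2]

theorem tuple_mem_vertical (k : ℕ) (B : ℤ → TgtRing k) (c : TgtRing k) :
    tuple k 0 B 0 c ∈ verticalFields k :=
  ⟨fun _ => rfl, rfl⟩

/-! ### Degrees in `y`: liftable normal forms vanish. -/

/-- The ring of polynomials in `u` and `v`. -/
abbrev ParamRing (k : ℕ) := MvPolynomial (Fin (k - 2) ⊕ Fin (k - 1)) ℝ

/-- A polynomial function on the source as a polynomial in `y`. -/
def toPoly (k : ℕ) : SrcRing k →ₐ[ℝ] Polynomial (ParamRing k) :=
  MvPolynomial.aeval (Sum.elim (fun i => Polynomial.C (MvPolynomial.X (Sum.inl i)))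
    (Sum.elim (fun i => Polynomial.C (MvPolynomial.X (Sum.inr i))) fun _ => Polynomial.X))

/-- Polynomials in `u` and `v` as functions on the target. -/
def ofParam (k : ℕ) : ParamRing k →ₐ[ℝ] TgtRing k :=
  MvPolynomial.rename (Sum.map id Sum.inl)

/-- Polynomials in `u`, `v` and `W_1` as functions on the target. -/
def ofParamW (k : ℕ) : Polynomial (ParamRing k) →+* TgtRing k :=
  Polynomial.eval₂RingHom (ofParam k : ParamRing k →+* TgtRing k) (W₁ k)

theorem toPoly_Y (k : ℕ) : toPoly k (Y k) = Polynomial.X := by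
  simp [toPoly, Y]

theorem toPoly_pullback_ofParam (k : ℕ) (r : ParamRing k) :
    toPoly k (pullback k (ofParam k r)) = Polynomial.C r := by
  have : ((toPoly k).comp (pullback k)).comp (ofParam k) =
      Polynomial.CAlgHom (R := ℝ) (A := ParamRing k) := by
    ext t
    rcases t with i | i <;> simp [toPoly, pullback, ofParam]
  exact DFunLike.congr_fun this r

theorem toPoly_pullback_ofParamW (k : ℕ) (t : Polynomial (ParamRing k)) :
    toPoly k (pullback k (ofParamW k t)) = t.comp (toPoly k (pullback k (W₁ k))) := by
  induction t using Polynomial.induction_on' with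
  | add p q hp hq => simp only [map_add, hp, hq, Polynomial.add_comp]
  | monomial n a =>
    simp [ofParamW, toPoly_pullback_ofParam, ← Polynomial.C_mul_X_pow_eq_monomial]

theorem le_degree_dP {k : ℕ} (hk : 2 ≤ k) : ((k - 1 : ℕ) : WithBot ℕ) ≤ (toPoly k (dP k)).degree := by
  apply Polynomial.le_degree_of_ne_zero
  rw [dP_eq hk]
  simp only [map_add, map_mul, map_pow, map_sum, map_natCast, map_one, toPoly_Y,
    Polynomial.coeff_add, Polynomial.finsetSum_coeff]
  rw [sum_eq_zero]
  · rw [← Polynomial.C_eq_natCast, Polynomial.coeff_C_mul_X_pow, if_pos rfl, add_zero]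
    exact Nat.cast_ne_zero.2 (by omega)
  · intro i _
    have := i.2
    have e : (toPoly k (MvPolynomial.X (Sum.inl i))) = Polynomial.C (MvPolynomial.X (Sum.inl i)) := by
      simp [toPoly]
    rw [e, ← Polynomial.C_eq_natCast, ← Polynomial.C_1, ← Polynomial.C_add, ← mul_assoc,
      ← Polynomial.C_mul, Polynomial.coeff_C_mul_X_pow, if_neg (by omega)]

theorem le_natDegree_W₁ {k : ℕ} (hk : 2 ≤ k) : k ≤ (toPoly k (pullback k (W₁ k))).natDegree := by
  apply Polynomial.le_natDegree_of_ne_zero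
  rw [pullback_W₁ hk, sum_uSeq_mul hk]
  simp only [map_add, map_mul, map_pow, map_sum, toPoly_Y,
    Polynomial.coeff_add, Polynomial.finsetSum_coeff]
  rw [sum_eq_zero]
  · simp
  · intro i _
    have := i.2
    have e : (toPoly k (MvPolynomial.X (Sum.inl i))) = Polynomial.C (MvPolynomial.X (Sum.inl i)) := by
      simp [toPoly]
    rw [e, Polynomial.coeff_C_mul_X_pow, if_neg (by omega)]

/-- A nonzero summand has degree `deg t_i * deg P + i`. These degrees are distinct modulo `deg P`
since `i < n ≤ deg P`, so no cancellation between summands is possible. -/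
theorem eq_zero_of_sum_comp_mul_X_pow {A : Type*} [CommRing A] [IsDomain A] {P : Polynomial A}
    {n : ℕ} (hn : n ≤ P.natDegree) (t : Fin n → Polynomial A)
    (h : ∑ i, (t i).comp P * Polynomial.X ^ (i : ℕ) = 0) (i : Fin n) : t i = 0 := by
  have hP : ¬ (P.natDegree = 0) := by have := i.2; omega
  have hcomp : ∀ p : Polynomial A, p.comp P = 0 → p = 0 := by
    intro p hp
    rcases Polynomial.comp_eq_zero_iff.1 hp with h | h
    · exact h
    · exact absurd (by rw [h.2]; simp) hP
  have hdeg : ∀ j, (t j).comp P * Polynomial.X ^ (j : ℕ) ≠ 0 →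
      ((t j).comp P * Polynomial.X ^ (j : ℕ)).degree =
        (((t j).natDegree * P.natDegree + j : ℕ) : WithBot ℕ) := by
    intro j hj
    rw [Polynomial.degree_eq_natDegree hj, Polynomial.natDegree_mul_X_pow _ (left_ne_zero_of_mul hj),
      Polynomial.natDegree_comp]
  have hs := Polynomial.degree_sum_eq_of_disjoint
    (fun j : Fin n => (t j).comp P * Polynomial.X ^ (j : ℕ)) univ (by
      rintro a ⟨-, ha⟩ b ⟨-, hb⟩ hab he
      simp only [Function.comp_apply, hdeg _ ha, hdeg _ hb, Nat.cast_inj] at he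
      have h1 := congrArg (· % P.natDegree) he
      simp only [Nat.mul_add_mod_self_right, Nat.mod_eq_of_lt (a.2.trans_le hn),
        Nat.mod_eq_of_lt (b.2.trans_le hn)] at h1
      exact hab (Fin.ext h1))
  rw [h, Polynomial.degree_zero] at hs
  have h2 := Finset.le_sup (f := fun j : Fin n => ((t j).comp P * Polynomial.X ^ (j : ℕ)).degree)
    (mem_univ i)
  rw [← hs, le_bot_iff, Polynomial.degree_eq_bot] at h2
  exact hcomp _ ((mul_eq_zero.1 h2).resolve_right (pow_ne_zero _ Polynomial.X_ne_zero))

/-- A liftable field whose `A`- and `C_1`-components only involve `U` and `V` is vertical. -/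
theorem eq_zero_of_liftable₁ {k : ℕ} (hk : 2 ≤ k) {κ : PolyField (Tgt k)}
    (hκ : κ ∈ verticalFields k) {c : Fin (k - 1) → TgtRing k}
    (hc : ∀ i, c i ∈ (ofParam k : ParamRing k →+* TgtRing k).range)
    (h : κ + ∑ i, c i • basis₁ k i ∈ liftablePolyFields (crossCap k) (contDiff_crossCap k)) :
    ∀ i, c i = 0 := by
  obtain ⟨g, hg, -⟩ := (mem_liftable_iff hk _).1 h
  choose r hr using hc
  rw [symb₁_add, symb₁_of_mem_vertical hκ, zero_add, symb₁_sum_smul] at hg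
  have hg' := congrArg (toPoly k) hg
  have e : toPoly k (∑ i, pullback k (c i) * symb₁ (basis₁ k i)) =
      ∑ i : Fin (k - 1), Polynomial.C (r i) * Polynomial.X ^ (i : ℕ) := by
    rw [map_sum]
    refine sum_congr rfl fun i _ => ?_
    rw [map_mul, symb₁_basis₁ hk i.2, map_pow, toPoly_Y, ← hr i]
    exact congrArg (· * _) (toPoly_pullback_ofParam k (r i))
  rw [e, map_mul] at hg'
  have hlt := Polynomial.degree_sum_fin_lt r
  -- The symbol has degree less than `k - 1` in `y` but is a multiple of `P'`, whose degree is at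
  -- least `k - 1`.
  have h0 : ∑ i : Fin (k - 1), Polynomial.C (r i) * Polynomial.X ^ (i : ℕ) = 0 := by
    by_contra hne
    rw [hg'] at hlt hne
    rw [Polynomial.degree_mul] at hlt
    have h1 := le_degree_dP hk
    have h2 := Polynomial.zero_le_degree_iff.2 (left_ne_zero_of_mul hne)
    have h3 := add_le_add h2 h1
    rw [zero_add] at h3
    exact absurd hlt (not_lt.2 h3)
  intro i
  have hi := congrArg (Polynomial.coeff · (i : ℕ)) h0
  simp only [Polynomial.finsetSum_coeff, Polynomial.coeff_zero] at hi
  rw [sum_eq_single i] at hi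
  · rw [Polynomial.coeff_C_mul_X_pow, if_pos rfl] at hi
    rw [← hr i, hi, map_zero]
  · intro j _ hj
    rw [Polynomial.coeff_C_mul_X_pow, if_neg fun h => hj (Fin.ext h.symm)]
  · simp

/-- A liftable vertical field whose components only involve `U`, `V` and `W_1` is zero. -/
theorem eq_zero_of_liftable₂ {k : ℕ} (hk : 2 ≤ k) {c : Fin k → TgtRing k}
    (hc : ∀ i, c i ∈ (ofParamW k).range)
    (h : ∑ i, c i • basis₂ k i ∈ liftablePolyFields (crossCap k) (contDiff_crossCap k)) :
    ∀ i, c i = 0 := by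
  obtain ⟨g, hg₁, hg₂⟩ := (mem_liftable_iff hk _).1 h
  choose r hr using hc
  have hP : dP k ≠ 0 := by
    intro h0
    have := le_degree_dP hk
    rw [h0, map_zero, Polynomial.degree_zero] at this
    exact absurd (le_bot_iff.1 this) (WithBot.natCast_ne_bot _)
  -- The first symbol of a vertical field is zero, so `g P' = 0`.
  have hg : g = 0 := by
    rw [symb₁_sum_smul, sum_eq_zero] at hg₁
    · exact (mul_eq_zero.1 hg₁.symm).resolve_right hP
    · intro i _
      rw [symb₁_basis₂ hk, mul_zero]
  rw [hg, zero_mul, symb₂_sum_smul] at hg₂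
  have hg' := congrArg (toPoly k) hg₂
  have h0 := eq_zero_of_sum_comp_mul_X_pow (le_natDegree_W₁ hk) r (by
    rw [map_zero, map_sum] at hg'
    rw [← hg']
    refine sum_congr rfl fun i _ => ?_
    rw [map_mul, symb₂_basis₂ hk i.2, map_pow, toPoly_Y, ← hr i, toPoly_pullback_ofParamW])
  intro i
  rw [← hr i, h0 i, map_zero]

/-! ### Eliminating `W_1` and `W_2` by means of the generators. -/

theorem C_mem_range_ofParam (k : ℕ) (a : ℝ) :
    MvPolynomial.C a ∈ (ofParam k : ParamRing k →+* TgtRing k).range :=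
  ⟨MvPolynomial.C a, by simp [ofParam]⟩

theorem X_inl_mem_range_ofParam (k : ℕ) (i : Fin (k - 2)) :
    MvPolynomial.X (Sum.inl i) ∈ (ofParam k : ParamRing k →+* TgtRing k).range :=
  ⟨MvPolynomial.X (Sum.inl i), by simp [ofParam]⟩

theorem X_inr_mem_range_ofParam (k : ℕ) (i : Fin (k - 1)) :
    MvPolynomial.X (Sum.inr (Sum.inl i)) ∈ (ofParam k : ParamRing k →+* TgtRing k).range :=
  ⟨MvPolynomial.X (Sum.inr i), by simp [ofParam]⟩

theorem U_mem_range_ofParam (k : ℕ) (r : ℤ) :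
    U k r ∈ (ofParam k : ParamRing k →+* TgtRing k).range := by
  unfold U
  split_ifs
  exacts [X_inl_mem_range_ofParam _ _, one_mem _, zero_mem _]

theorem V_mem_range_ofParam (k : ℕ) (r : ℤ) :
    V k r ∈ (ofParam k : ParamRing k →+* TgtRing k).range := by
  unfold V
  split_ifs
  exacts [X_inr_mem_range_ofParam _ _, zero_mem _]

theorem W₁_mem_range_ofParamW (k : ℕ) : W₁ k ∈ (ofParamW k).range :=
  ⟨Polynomial.X, by simp [ofParamW]⟩

theorem range_ofParam_le (k : ℕ) :
    (ofParam k : ParamRing k →+* TgtRing k).range ≤ (ofParamW k).range := by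
  rintro _ ⟨r, rfl⟩
  exact ⟨Polynomial.C r, by simp [ofParamW]⟩

/-- The reduced elements form a module over the whole polynomial ring as soon as they are stable
under `W_1` and `W_2`. -/
theorem smul_mem_reduced_of_W {k : ℕ} {M : Type*} [AddCommGroup M] [Module (TgtRing k) M]
    {R : Subring (TgtRing k)} (hR : (ofParam k : ParamRing k →+* TgtRing k).range ≤ R)
    {G : Submodule (TgtRing k) M} {n : ℕ} {e : ℕ → M}
    (h₁ : ∀ x ∈ reduced R G n e, W₁ k • x ∈ reduced R G n e)
    (h₂ : ∀ x ∈ reduced R G n e, W₂ k • x ∈ reduced R G n e) (p : TgtRing k) :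
    ∀ x ∈ reduced R G n e, p • x ∈ reduced R G n e := by
  induction p using MvPolynomial.induction_on with
  | C a => exact fun x hx => smul_mem_reduced (hR (C_mem_range_ofParam k a)) hx
  | add p q hp hq =>
    intro x hx
    rw [add_smul]
    exact add_mem (hp x hx) (hq x hx)
  | mul_X p t hp =>
    intro x hx
    rw [mul_smul]
    apply hp
    rcases t with i | i | i
    · exact smul_mem_reduced (hR (X_inl_mem_range_ofParam k i)) hx
    · exact smul_mem_reduced (hR (X_inr_mem_range_ofParam k i)) hx
    · fin_cases i
      · exact h₁ x hx
      · exact h₂ x hx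

/-- The coefficients of `k P'(y)` divided by `y^{k - 1 - a}`. -/
def leadCoeff (k a : ℕ) (i : ℤ) : TgtRing k :=
  k * ((k - a + i : ℤ) : TgtRing k) * U k (k - a + i)

theorem natCast_inv_mul {k n : ℕ} (hn : n ≠ 0) :
    MvPolynomial.C ((n : ℝ)⁻¹) * (n : TgtRing k) = 1 := by
  rw [← map_natCast (MvPolynomial.C (σ := Tgt k) (R := ℝ)) n, ← map_mul,
    inv_mul_cancel₀ (Nat.cast_ne_zero.2 hn), map_one]

/-- Modulo vertical fields, `ζ` is `w` times `∑ leadCoeff k a i • basis₁ k i` plus terms with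
coefficients in `ℝ[U, V]`. Since `U_r = 0` for `r > k` and `U_k = 1`, the coefficients vanish for `i
> a` and equal `k^2` at `i = a`, so the system is triangular with invertible diagonal. -/
theorem smul_mem_reduced_of_family {k : ℕ} (hk : 2 ≤ k) {w : TgtRing k}
    {G : Submodule (TgtRing k) (PolyField (Tgt k))}
    (h : ∀ a < k - 1, ∃ d : ℤ → TgtRing k,
      (∀ i, d i ∈ (ofParam k : ParamRing k →+* TgtRing k).range) ∧ ∃ ζ ∈ G, ∃ B C₂,
        ζ = tuple k (fun i => -(w * leadCoeff k a i + d i)) B (w * leadCoeff k a 0 + d 0) C₂) :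
    ∀ x ∈ reduced (ofParam k : ParamRing k →+* TgtRing k).range (G ⊔ verticalFields k) (k - 1)
        (basis₁ k),
      w • x ∈ reduced (ofParam k : ParamRing k →+* TgtRing k).range (G ⊔ verticalFields k) (k - 1)
        (basis₁ k) := by
  intro x hx
  refine smul_mem_reduced_of_triangular (fun a ha => ?_) hx
  obtain ⟨d, hd, ζ, hG, B, C₂, hζ⟩ := h a ha
  refine ⟨fun i => leadCoeff k a i, fun i => ?_, ⟨MvPolynomial.C (((k * k : ℕ) : ℝ)⁻¹),
    C_mem_range_ofParam k _, ?_⟩, ?_⟩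
  · exact mul_mem (mul_mem (natCast_mem _ _) (intCast_mem _ _)) (U_mem_range_ofParam k _)
  · simp only [leadCoeff]
    rw [sub_add_cancel, U_top, mul_one, Int.cast_natCast, ← Nat.cast_mul,
      natCast_inv_mul (by positivity)]
  · have hs : ∑ i ∈ range (a + 1), leadCoeff k a i • basis₁ k i =
        ∑ i ∈ range (k - 1), leadCoeff k a i • basis₁ k i := by
      refine sum_subset (fun i => ?_) fun i _ hi => ?_
      · simp only [mem_range]
        omega
      · simp only [mem_range] at hi
        rw [leadCoeff, U_of_gt (by omega), mul_zero, zero_smul]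
    have e : w • ∑ i ∈ range (k - 1), leadCoeff k a i • basis₁ k i =
        (ζ - tuple k 0 B 0 C₂) - ∑ i ∈ range (k - 1), d i • basis₁ k i := by
      rw [hζ, sum_smul_basis₁ hk, sum_smul_basis₁ hk, smul_tuple, tuple_sub, tuple_sub]
      refine tuple_congr (fun i _ _ => ?_) (fun i _ _ => ?_) ?_ ?_
      · simp only [Pi.zero_apply]
        ring
      · simp only [Pi.zero_apply]
        ring
      · ring
      · ring
    rw [hs, e]
    exact sub_mem (mem_reduced_of_mem (sub_mem (Submodule.mem_sup_left hG)
      (Submodule.mem_sup_right (tuple_mem_vertical k B C₂))))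
      (sum_smul_mem_reduced fun i => hd i)

theorem generator_mem {k : ℕ} {j : ℤ} (hj : 1 ≤ j) (hjk : j ≤ (k : ℤ) - 1) :
    xi₁ k j ∈ Submodule.span (TgtRing k) (generators k) ∧
    xi₂ k j ∈ Submodule.span (TgtRing k) (generators k) ∧
    xi₃ k j ∈ Submodule.span (TgtRing k) (generators k) := by
  refine ⟨?_, ?_, ?_⟩ <;>
  · refine Submodule.subset_span (Or.inr (Set.mem_iUnion₂.2 ⟨j, ⟨hj, hjk⟩, ?_⟩))
    simp

theorem eulerField_mem_span (k : ℕ) :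
    eulerField k ∈ Submodule.span (TgtRing k) (generators k) :=
  Submodule.subset_span (Or.inl rfl)

theorem W₁_smul_mem_reduced {k : ℕ} (hk : 2 ≤ k) :
    ∀ x ∈ reduced (ofParam k : ParamRing k →+* TgtRing k).range
        (Submodule.span (TgtRing k) (generators k) ⊔ verticalFields k) (k - 1) (basis₁ k),
      W₁ k • x ∈ reduced (ofParam k : ParamRing k →+* TgtRing k).range
        (Submodule.span (TgtRing k) (generators k) ⊔ verticalFields k) (k - 1) (basis₁ k) := by
  refine smul_mem_reduced_of_family hk fun a ha => ?_
  have e : xi₂ k (a + 1) ∈ Submodule.span (TgtRing k) (generators k) :=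
    (generator_mem (by omega) (by omega)).2.1
  refine ⟨fun i => -((k : TgtRing k) * ∑ r ∈ Icc 1 i, ((k + i - (a + 1) - 2 * r + 1 : ℤ) : TgtRing k)
      * U k r * U k (k + i - (a + 1) - r + 1)) +
      (((a + 1) * (i + 1) : ℤ) : TgtRing k) * U k (i + 1) * U k (k - (a + 1)), fun i => ?_, ?_⟩
  · exact add_mem (neg_mem (mul_mem (natCast_mem _ _) (sum_mem fun r _ => mul_mem (mul_mem
      (intCast_mem _ _) (U_mem_range_ofParam k _)) (U_mem_range_ofParam k _)))) (mul_mem (mul_mem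
      (intCast_mem _ _) (U_mem_range_ofParam k _)) (U_mem_range_ofParam k _))
  · refine ⟨_, e, _, _, tuple_congr (fun i _ _ => ?_) (fun _ _ _ => rfl) ?_ rfl⟩
    · rw [leadCoeff, show (k : ℤ) + i - (a + 1) + 1 = k - a + i by ring]
      push_cast
      ring
    · rw [leadCoeff, show (k : ℤ) - (a + 1) + 1 = k - a + 0 by ring]
      -- At `i = 0` the sum is empty, so the formula for the remainder of `A_i` also yields that of
      -- `C_1`.
      simp only [show Icc (1 : ℤ) 0 = ∅ from rfl, sum_empty]
      push_cast
      ring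

theorem W₂_smul_mem_reduced {k : ℕ} (hk : 2 ≤ k) :
    ∀ x ∈ reduced (ofParam k : ParamRing k →+* TgtRing k).range
        (Submodule.span (TgtRing k) (generators k) ⊔ verticalFields k) (k - 1) (basis₁ k),
      W₂ k • x ∈ reduced (ofParam k : ParamRing k →+* TgtRing k).range
        (Submodule.span (TgtRing k) (generators k) ⊔ verticalFields k) (k - 1) (basis₁ k) := by
  refine smul_mem_reduced_of_family hk fun a ha => ?_
  have e : xi₃ k (a + 1) ∈ Submodule.span (TgtRing k) (generators k) :=
    (generator_mem (by omega) (by omega)).2.2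
  refine ⟨fun i => -((k : TgtRing k) * ∑ r ∈ Icc 1 i, ((k + i - (a + 1) - r + 1 : ℤ) : TgtRing k)
      * U k (k + i - (a + 1) - r + 1) * V k r) +
      (k : TgtRing k) * (∑ r ∈ Icc 1 i, (r : TgtRing k) * U k r * V k (k + i - (a + 1) - r + 1)) +
      ((k * (i + 1) : ℤ) : TgtRing k) * U k (i + 1) * V k (k - (a + 1)), fun i => ?_, ?_⟩
  · exact add_mem (add_mem (neg_mem (mul_mem (natCast_mem _ _) (sum_mem fun r _ => mul_mem (mul_mem
      (intCast_mem _ _) (U_mem_range_ofParam k _)) (V_mem_range_ofParam k _))))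
      (mul_mem (natCast_mem _ _) (sum_mem fun r _ => mul_mem (mul_mem
      (intCast_mem _ _) (U_mem_range_ofParam k _)) (V_mem_range_ofParam k _))))
      (mul_mem (mul_mem (intCast_mem _ _) (U_mem_range_ofParam k _)) (V_mem_range_ofParam k _))
  · refine ⟨_, e, _, _, tuple_congr (fun i _ _ => ?_) (fun _ _ _ => rfl) ?_ rfl⟩
    · rw [leadCoeff, show (k : ℤ) + i - (a + 1) + 1 = k - a + i by ring]
      push_cast
      ring
    · rw [leadCoeff, show (k : ℤ) - (a + 1) + 1 = k - a + 0 by ring]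
      simp only [show Icc (1 : ℤ) 0 = ∅ from rfl, sum_empty]
      push_cast
      ring

/-- The Euler field in the directions `V` and `W_2`, up to the factor `k^2`. -/
theorem vertical_euler_eq (k : ℕ) :
    (k : TgtRing k) • eulerField k - xi₂ k 1 =
      tuple k 0 (fun i => (k * k : TgtRing k) * V k i) 0 ((k * k : TgtRing k) * W₂ k) := by
  rw [eulerField, xi₂, smul_tuple, tuple_sub]
  refine tuple_congr (fun i h1 h2 => ?_) (fun i h1 h2 => ?_) ?_ ?_
  -- The factor `U_{k-1}` is zero, and `U_{k+i-r}` with `r ≤ i` survives only for `r = i`.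
  · rw [U_pred, sum_eq_single i, show (k : ℤ) + i - 1 - i + 1 = k by ring, U_top,
      U_of_gt (r := k + i - 1 + 1) (by omega)]
    · simp only [Pi.zero_apply]
      push_cast
      ring
    · intro r hr hri
      simp only [mem_Icc] at hr
      rw [U_of_gt (r := k + i - 1 - r + 1) (by omega), mul_zero]
    · intro h
      simp only [mem_Icc] at h
      omega
  · rw [U_pred, V_of_ge (r := k + i - 1 + 1) (by omega), sum_eq_zero, sum_eq_single i,
      show (k : ℤ) + i - 1 - i + 1 = k by ring, U_top]
    · push_cast
      ring
    · intro r hr hri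
      simp only [mem_Icc] at hr
      rw [U_of_gt (by omega), mul_zero, zero_mul]
    · intro h
      simp only [mem_Icc] at h
      omega
    · intro r hr
      simp only [mem_Icc] at hr
      rw [V_of_ge (by omega), mul_zero]
  · rw [U_pred, sub_add_cancel, U_top]
    push_cast
    ring
  · rw [U_pred, sub_add_cancel, V_of_ge le_rfl]
    ring

/-- Subtracting `(k - j) U_j ξ_e` makes `ξ^1_j` vertical. Its `W_2`-part is triangular in `a = k -
j`, and the remainder involves `W_1`, which is why the coefficients here are taken in `ℝ[U, V,
W_1]`. -/
theorem W₂_smul_mem_reduced_vertical {k : ℕ} (hk : 2 ≤ k) :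
    ∀ x ∈ reduced (ofParamW k).range (Submodule.span (TgtRing k) (generators k)) k (basis₂ k),
      W₂ k • x ∈
        reduced (ofParamW k).range (Submodule.span (TgtRing k) (generators k)) k (basis₂ k) := by
  have hU (r : ℤ) : U k r ∈ (ofParamW k).range := range_ofParam_le k (U_mem_range_ofParam k r)
  have hV (r : ℤ) : V k r ∈ (ofParamW k).range := range_ofParam_le k (V_mem_range_ofParam k r)
  have hC (a : ℝ) : MvPolynomial.C a ∈ (ofParamW k).range :=
    range_ofParam_le k (C_mem_range_ofParam k a)
  intro x hx
  refine smul_mem_reduced_of_triangular (fun a ha => ?_) hx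
  -- The case `a = 0` would need `j = k`, outside the family; `k ξ_e - ξ^2_1`, with `C_2 = k^2 W_2`,
  -- takes its place.
  rcases Nat.eq_zero_or_pos a with rfl | hpos
  · refine ⟨fun _ => (k * k : ℕ), fun i => natCast_mem _ _, ⟨MvPolynomial.C (((k * k : ℕ) : ℝ)⁻¹),
      hC _, natCast_inv_mul (by positivity)⟩, ?_⟩
    let d : ℤ → TgtRing k := fun i => if i = 0 then 0 else (k * k : TgtRing k) * V k i
    have hd (i : ℤ) : d i ∈ (ofParamW k).range := by
      simp only [d]
      split_ifs
      exacts [zero_mem _, mul_mem (mul_mem (natCast_mem _ _) (natCast_mem _ _)) (hV i)]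
    have e : W₂ k • ∑ i ∈ range (0 + 1), ((k * k : ℕ) : TgtRing k) • basis₂ k i =
        ((k : TgtRing k) • eulerField k - xi₂ k 1) + ∑ i ∈ range k, d i • basis₂ k i := by
      rw [vertical_euler_eq k, sum_smul_basis₂ hk, zero_add, sum_range_one, basis₂, smul_tuple,
        smul_tuple, tuple_add]
      refine tuple_congr (fun i _ _ => ?_) (fun i h1 _ => ?_) ?_ ?_
      · simp
      · have : i ≠ 0 := by omega
        simp [d, this]
      · simp
      · simp [d]
        ring
    rw [e]
    exact add_mem (mem_reduced_of_mem (sub_mem (Submodule.smul_mem _ _ (eulerField_mem_span k))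
      (generator_mem le_rfl (by omega)).2.1)) (sum_smul_mem_reduced fun i => hd i)
  · obtain ⟨j, hj⟩ : ∃ j : ℤ, j = k - a := ⟨_, rfl⟩
    -- The entry at `i = 0` is the `W_2`-coefficient of `C_2`: `(k - j) U_j` from `ξ^1_j`, minus `k
    -- (k - j) U_j` from the Euler field. The others come from `-k U_{i+j} W_2` in `B_i`, last
    -- nonzero at `i = a`.
    let b : ℤ → TgtRing k := fun i =>
      if i = 0 then ((k - j - k * (k - j) : ℤ) : TgtRing k) * U k j else k * U k (i + j)
    let d : ℤ → TgtRing k := fun i => if i = 0 then -(k * V k j * W₁ k) else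
      -((k : TgtRing k) * (∑ r ∈ Icc 1 (i - 1), U k (i + j - r) * V k r)
        - (k : TgtRing k) * (∑ r ∈ Icc 1 i, U k r * V k (i + j - r))
        - (((i - 1) * (k - j) : ℤ) : TgtRing k) * U k j * V k i
        + (k : TgtRing k) * V k (i + j) * W₁ k
        - ((k - j : ℤ) : TgtRing k) * U k j * (((k - i : ℤ) : TgtRing k) * V k i))
    have hb (i : ℤ) : b i ∈ (ofParamW k).range := by
      simp only [b]
      split_ifs
      exacts [mul_mem (intCast_mem _ _) (hU _), mul_mem (natCast_mem _ _) (hU _)]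
    have hW := W₁_mem_range_ofParamW k
    have hd (i : ℤ) : d i ∈ (ofParamW k).range := by
      simp only [d]
      split_ifs
      · exact neg_mem (mul_mem (mul_mem (natCast_mem _ _) (hV _)) hW)
      · exact neg_mem (sub_mem (add_mem (sub_mem (sub_mem
          (mul_mem (natCast_mem _ _) (sum_mem fun r _ => mul_mem (hU _) (hV _)))
          (mul_mem (natCast_mem _ _) (sum_mem fun r _ => mul_mem (hU _) (hV _))))
          (mul_mem (mul_mem (intCast_mem _ _) (hU _)) (hV _)))
          (mul_mem (mul_mem (natCast_mem _ _) (hV _)) hW))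
          (mul_mem (mul_mem (intCast_mem _ _) (hU _)) (mul_mem (intCast_mem _ _) (hV _))))
    refine ⟨fun i => b i, fun i => hb i, ⟨MvPolynomial.C ((k : ℝ)⁻¹), hC _, ?_⟩, ?_⟩
    · simp only [b]
      rw [if_neg (by omega), show (a : ℤ) + j = k by omega, U_top, mul_one,
        natCast_inv_mul (by omega)]
    · have hs : ∑ i ∈ range (a + 1), b i • basis₂ k i = ∑ i ∈ range k, b i • basis₂ k i := by
        refine sum_subset (fun i => ?_) fun i _ hi => ?_
        · simp only [mem_range]
          omega
        · simp only [mem_range] at hi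
          simp only [b]
          rw [if_neg (by omega), U_of_gt (by omega), mul_zero, zero_smul]
      have e : W₂ k • ∑ i ∈ range k, b i • basis₂ k i =
          (xi₁ k j - (((k - j : ℤ) : TgtRing k) * U k j) • eulerField k) -
            ∑ i ∈ range k, d i • basis₂ k i := by
        rw [sum_smul_basis₂ hk, sum_smul_basis₂ hk, xi₁, eulerField, smul_tuple, smul_tuple,
          tuple_sub, tuple_sub]
        refine tuple_congr (fun i _ _ => ?_) (fun i h1 _ => ?_) ?_ ?_
        · simp only [Pi.zero_apply]
          push_cast
          ring
        · simp only [b, d]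
          rw [if_neg (by omega), if_neg (by omega)]
          ring
        · push_cast
          ring
        · simp only [b, d, if_true]
          push_cast
          ring
      rw [hs, e]
      exact sub_mem (mem_reduced_of_mem (sub_mem (generator_mem (by omega) (by omega)).1
        (Submodule.smul_mem _ _ (eulerField_mem_span k)))) (sum_smul_mem_reduced fun i => hd i)

/-! ### Every field has a normal form; conclusion. -/

theorem eq_sum_smul_single {k : ℕ} (ξ : PolyField (Tgt k)) :
    ξ = ∑ t, ξ t • (Pi.single t 1 : PolyField (Tgt k)) := by
  funext s
  simp [Pi.single_apply]

theorem single_inl_eq (k : ℕ) (i : Fin (k - 2)) :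
    (Pi.single (Sum.inl i) 1 : PolyField (Tgt k)) = -basis₁ k (i + 1) := by
  funext t
  rcases t with l | l | l
  · simp [basis₁, tuple, Pi.single_apply, Fin.ext_iff, apply_ite]
  · simp [basis₁, tuple]
  · fin_cases l <;> simp [basis₁, tuple]

theorem single_inr_eq (k : ℕ) (i : Fin (k - 1)) :
    (Pi.single (Sum.inr (Sum.inl i)) 1 : PolyField (Tgt k)) = -basis₂ k (i + 1) := by
  funext t
  rcases t with l | l | l
  · simp [basis₂, tuple]
  · simp [basis₂, tuple, Pi.single_apply, Fin.ext_iff, apply_ite]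
  · fin_cases l <;> simp [basis₂, tuple]

theorem single_W₁_eq {k : ℕ} :
    (Pi.single (Sum.inr (Sum.inr 0)) 1 : PolyField (Tgt k)) = basis₁ k 0 := by
  funext t
  rcases t with l | l | l
  · have : ¬ ((l : ℤ) + 1 = 0) := by omega
    simp [basis₁, tuple, this]
  · simp [basis₁, tuple]
  · fin_cases l <;> simp [basis₁, tuple]

theorem single_W₂_eq {k : ℕ} :
    (Pi.single (Sum.inr (Sum.inr 1)) 1 : PolyField (Tgt k)) = basis₂ k 0 := by
  funext t
  rcases t with l | l | l
  · simp [basis₂, tuple]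
  · have : ¬ ((l : ℤ) + 1 = 0) := by omega
    simp [basis₂, tuple, this]
  · fin_cases l <;> simp [basis₂, tuple]

theorem basis₂_mem_vertical (k a : ℕ) : basis₂ k a ∈ verticalFields k := tuple_mem_vertical k _ _

theorem mem_reduced₁ {k : ℕ} (hk : 2 ≤ k) (ξ : PolyField (Tgt k)) :
    ξ ∈ reduced (ofParam k : ParamRing k →+* TgtRing k).range
        (Submodule.span (TgtRing k) (generators k) ⊔ verticalFields k) (k - 1) (basis₁ k) := by
  rw [eq_sum_smul_single ξ]
  refine Submodule.sum_mem _ fun t _ => smul_mem_reduced_of_W le_rfl (W₁_smul_mem_reduced hk)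
    (W₂_smul_mem_reduced hk) _ _ ?_
  rcases t with i | i | i
  · rw [single_inl_eq]
    exact neg_mem (basis_mem_reduced (by omega))
  · rw [single_inr_eq]
    exact neg_mem (mem_reduced_of_mem (Submodule.mem_sup_right (basis₂_mem_vertical k _)))
  · fin_cases i
    · exact single_W₁_eq (k := k) ▸ basis_mem_reduced (by omega)
    · exact single_W₂_eq (k := k) ▸
        mem_reduced_of_mem (Submodule.mem_sup_right (basis₂_mem_vertical k _))

theorem mem_reduced₂ {k : ℕ} (hk : 2 ≤ k) {ξ : PolyField (Tgt k)} (hξ : ξ ∈ verticalFields k) :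
    ξ ∈ reduced (ofParamW k).range (Submodule.span (TgtRing k) (generators k)) k (basis₂ k) := by
  rw [eq_sum_smul_single ξ]
  have hS := smul_mem_reduced_of_W (range_ofParam_le k)
    (fun x hx => smul_mem_reduced (W₁_mem_range_ofParamW k) hx) (W₂_smul_mem_reduced_vertical hk)
  refine Submodule.sum_mem _ fun t _ => ?_
  rcases t with i | i | i
  · rw [hξ.1, zero_smul]
    exact zero_mem _
  · rw [single_inr_eq]
    exact hS _ _ (neg_mem (basis_mem_reduced (by omega)))
  · fin_cases i
    · have h0 := hξ.2
      simp only [Fin.zero_eta, h0, zero_smul]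
      exact zero_mem _
    · exact hS _ _ (single_W₂_eq (k := k) ▸ basis_mem_reduced (by omega))

theorem liftable_le_span {k : ℕ} (hk : 2 ≤ k) :
    liftablePolyFields (crossCap k) (contDiff_crossCap k) ≤
      Submodule.span (TgtRing k) (generators k) := by
  intro ξ hξ
  obtain ⟨x, hx, c, hc, rfl⟩ := exists_of_mem_reduced (mem_reduced₁ hk ξ)
  obtain ⟨g, hg, κ, hκ, rfl⟩ := Submodule.mem_sup.1 hx
  -- Generators being liftable, the normal form left after removing `g` is liftable too, so the
  -- degree arguments apply to it.
  rw [add_assoc, Submodule.add_mem_iff_right _ (span_generators_le hk hg)] at hξ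
  have h0 := eq_zero_of_liftable₁ hk hκ hc hξ
  simp only [h0, zero_smul, sum_const_zero, add_zero] at hξ ⊢
  refine add_mem hg ?_
  obtain ⟨g', hg', c', hc', rfl⟩ := exists_of_mem_reduced (mem_reduced₂ hk hκ)
  rw [Submodule.add_mem_iff_right _ (span_generators_le hk hg')] at hξ
  have h0' := eq_zero_of_liftable₂ hk hc' hξ
  simpa only [h0', zero_smul, sum_const_zero, add_zero] using hg'

end CrossCap

end

theorem mainTheorem6 (k : ℕ) (hk : 2 ≤ k) :
    CrossCap.liftablePolyFields (CrossCap.crossCap k) (CrossCap.contDiff_crossCap k) =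
      Submodule.span (MvPolynomial (CrossCap.Tgt k) ℝ) (CrossCap.generators k) := by
  exact le_antisymm (CrossCap.liftable_le_span hk) (CrossCap.span_generators_le hk)
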